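/- For every $N\ge 1$ let $X=X^{(N)}=(X_{ij})_{1\le i,j\le N}$ be an $N\times N$ Hermitian random matrix with complex entries, whose entries $X_{ij}$, $i\le j$, are independent. No relation is assumed between different values of $N$; the matrices may be defined on different probability spaces. For positive functions of $N$, write $A\ll B$ (or $B\gg A$) if $A/B\to 0$ as $N\to\infty$; an entry is called identically zero if it vanishes almost surely. Assume that there is a sequence of integers $W=W(N)$ with $1\ll W\ll N$ such that every row of $X$ has at most $W$ non-identically-zero entries, and the number of rows that do not have exactly $W$ such entries is $o(N)$ as $N\to\infty$. Assume that every non-identically-zero entry satisfies $\mathbb{E}[X_{ij}]=0$ and $\mathbb{E}[|X_{ij}|^2]=1$, and that there are constants $C,\alpha\in[0,\infty)$ such that $$\mathbb{E}\big[|X_{ij}|^k\big]\le (Ck)^{\alpha k}\qquad\text{for all integers } k\ge 2,\text{ all } N \text{ and all } 1\le i,j\le N.$$ Suppose moreover that $W\gg(\log N)^{6(1+\alpha)}$. Then, denoting by $\lambda_{\max}(X)$ the largest eigenvalue of $X$, $$\frac{\lambda_{\max}(X)}{\sqrt{W}}\longrightarrow 2\qquad\text{in probability as } N\to\infty,$$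 that is, for every $\varepsilon>0$, $\mathbb{P}\big(|\lambda_{\max}(X)/\sqrt W-2|\ge\varepsilon\big)\to 0$. -/

import Mathlib

open MeasureTheory ProbabilityTheory Filter Topology Asymptotics

/-- The largest eigenvalue of an `N × N` Hermitian matrix
(the finite maximum of its real eigenvalues when `N ≥ 1`). -/
noncomputable def lambdaMax {N : ℕ} {A : Matrix (Fin N) (Fin N) ℂ} (hA : A.IsHermitian) : ℝ :=
  ⨆ i : Fin N, hA.eigenvalues i

/-- The entry `(i, j)` of the random matrix `X` is not identically zero as a random variable,
i.e. it is not almost surely equal to zero. -/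
def EntryNonzero {N : ℕ} {Ω : Type*} [MeasurableSpace Ω] (P : Measure Ω)
    (X : Ω → Matrix (Fin N) (Fin N) ℂ) (i j : Fin N) : Prop :=
  ¬ ∀ᵐ ω ∂P, X ω i j = 0

/-- The number of not identically zero entries in row `i` of the random matrix `X`. -/
noncomputable def rowCount {N : ℕ} {Ω : Type*} [MeasurableSpace Ω] (P : Measure Ω)
    (X : Ω → Matrix (Fin N) (Fin N) ℂ) (i : Fin N) : ℕ :=
  {j : Fin N | EntryNonzero P X i j}.ncard

/-! The two tails are treated by different methods.

Upper tail: for even `n` of order `log N`, Markov's inequality reduces the claim to a bound on the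
expectation of `tr (X ^ n)`, a sum over walks of length `n`. A walk contributes only if no unordered
pair is traversed exactly once. Instead of classifying the shapes of such walks, each partial walk
gets a `potential`: a factor `γ⁻¹` for every edge still open (traversed once), powers of `M` for
deviation from a depth-first tree exploration, and powers of `K` for edges traversed more than
twice. Opening an edge costs `γ⁻¹` with about `W` choices, and closing one restores `γ` with
essentially one choice. So, when `γ ^ 2 = W + M ^ 3`, one step multiplies the total potential by at
most `2 * γ + M ^ 2 * K` (`sum_potential_cons_le`). A walk without open edges has potential at least
its expectation, whence `integral_trace_pow_re_le`. As `W` dominates the relevant power of `log N`,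
the growth rate is `(2 + o(1)) √W`, and the factor `N` is absorbed by the `n`-th power.

Lower tail: let `s (m + 1)` be `W ^ (-m / 2)` times the vector of sums of entry products over
self-avoiding walks of length `m` from `i`. A further step goes to a new vertex, backtracks, or
closes a loop. Backtracking produces `|X| ^ 2`, whose mean is one, with about `W` choices. Hence `X
s (m + 1) = √W (s (m + 2) + s m + r (m + 1))`, the Chebyshev recursion with an error
(`mulVec_normSaw`). If the errors are nearly orthogonal to the vectors `s l`, Hermitian symmetry
makes these vectors nearly orthonormal, and their sum over `d` indices has Rayleigh quotient at
least `√W (2 - 8 / d)` (`lambdaMax_ge_of_chebyshev`). The errors are controlled by second moments: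
products along self-avoiding walks with different vertex sets are uncorrelated, and only boundedly
many walks share a vertex set. Averaging over `i` makes the errors `O(1 / W)` plus a multiple of the
fraction of rows with the wrong number of nonzero entries. -/

/-! ### Deterministic bounds for the largest eigenvalue. -/

theorem Matrix.IsHermitian.trace_pow {N : ℕ} {A : Matrix (Fin N) (Fin N) ℂ} (hA : A.IsHermitian)
    (n : ℕ) : (A ^ n).trace = ∑ i, (hA.eigenvalues i : ℂ) ^ n := by
  conv_lhs => rw [hA.spectral_theorem, ← map_pow, Unitary.conjStarAlgAut_apply,
    Matrix.trace_mul_cycle, Unitary.coe_star_mul_self, one_mul, Matrix.diagonal_pow]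
  simp [Matrix.trace_diagonal]

theorem eigenvalues_le_lambdaMax {N : ℕ} {A : Matrix (Fin N) (Fin N) ℂ} (hA : A.IsHermitian)
    (i : Fin N) : hA.eigenvalues i ≤ lambdaMax hA :=
  le_ciSup (Set.finite_range _).bddAbove i

theorem lambdaMax_pow_le_trace {N : ℕ} (hN : 0 < N) {A : Matrix (Fin N) (Fin N) ℂ}
    (hA : A.IsHermitian) {n : ℕ} (hn : Even n) : lambdaMax hA ^ n ≤ (A ^ n).trace.re := by
  have : Nonempty (Fin N) := ⟨⟨0, hN⟩⟩
  obtain ⟨i, hi⟩ := exists_eq_ciSup_of_finite (f := hA.eigenvalues)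
  have h : (A ^ n).trace.re = ∑ i, hA.eigenvalues i ^ n := by
    rw [hA.trace_pow, Complex.re_sum]
    refine Finset.sum_congr rfl fun i _ => ?_
    rw [← Complex.ofReal_pow, Complex.ofReal_re]
  rw [h, lambdaMax, ← hi]
  exact Finset.single_le_sum (f := fun i => hA.eigenvalues i ^ n)
    (fun j _ => hn.pow_nonneg _) (Finset.mem_univ i)

theorem re_dotProduct_mulVec_le_lambdaMax {N : ℕ} {A : Matrix (Fin N) (Fin N) ℂ}
    (hA : A.IsHermitian) (v : Fin N → ℂ) :
    (star v ⬝ᵥ A.mulVec v).re ≤ lambdaMax hA * (star v ⬝ᵥ v).re := by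
  set U : Matrix (Fin N) (Fin N) ℂ := (hA.eigenvectorUnitary : Matrix (Fin N) (Fin N) ℂ) with hU
  set w := (star U).mulVec v with hw
  have hUU : U * star U = 1 := Unitary.coe_mul_star_self _
  have hv : v = U.mulVec w := by rw [hw, Matrix.mulVec_mulVec, hUU, Matrix.one_mulVec]
  have hAU : A = U * Matrix.diagonal (RCLike.ofReal ∘ hA.eigenvalues) * star U := by
    conv_lhs => rw [hA.spectral_theorem, Unitary.conjStarAlgAut_apply]
  have hsw : star w = Matrix.vecMul (star v) U := by
    rw [hw, Matrix.star_mulVec]; simp [Matrix.star_eq_conjTranspose]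
  have h1 : star v ⬝ᵥ A.mulVec v
      = star w ⬝ᵥ (Matrix.diagonal (RCLike.ofReal ∘ hA.eigenvalues)).mulVec w := by
    conv_lhs => rw [hAU]
    rw [← Matrix.mulVec_mulVec, ← Matrix.mulVec_mulVec, ← hw, Matrix.dotProduct_mulVec, ← hsw]
  have h2 : star v ⬝ᵥ v = star w ⬝ᵥ w := by
    conv_lhs => rw [hv, Matrix.dotProduct_mulVec, ← hv, ← hsw]
  rw [h1, h2]
  simp only [dotProduct, Matrix.mulVec_diagonal, Complex.re_sum, Finset.mul_sum]
  refine Finset.sum_le_sum fun i _ => ?_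
  have h3 : (star w i * w i).re = ‖w i‖ ^ 2 := by
    rw [Pi.star_apply, RCLike.star_def, mul_comm, Complex.mul_conj, Complex.ofReal_re,
      Complex.normSq_eq_norm_sq]
  have h4 : (star w i * ((RCLike.ofReal ∘ hA.eigenvalues) i * w i)).re
      = hA.eigenvalues i * (star w i * w i).re := by
    rw [mul_left_comm]; exact Complex.re_ofReal_mul _ _
  rw [h4, h3]
  exact mul_le_mul_of_nonneg_right (eigenvalues_le_lambdaMax hA i) (by positivity)

/-- If the vectors `s 1, s 2, …` approximately satisfy the Chebyshev recursion for `A / c`,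
and `s 1` is a unit vector orthogonal to the others, they are approximately orthonormal. -/
theorem norm_dotProduct_sub_le_of_chebyshev {N : ℕ} {A : Matrix (Fin N) (Fin N) ℂ}
    (hA : A.IsHermitian) {c δ : ℝ} (hc : 0 < c) (hδ : 0 ≤ δ) (s r : ℕ → Fin N → ℂ) (D : ℕ)
    (hs : s 0 = 0)
    (hrec : ∀ m, A.mulVec (s (m + 1)) = (c : ℂ) • (s (m + 2) + s m + r (m + 1)))
    (h1 : ∀ m, star (s 1) ⬝ᵥ s m = if m = 1 then 1 else 0)
    (hr : ∀ l m, l ≤ D → m ≤ D → ‖star (s l) ⬝ᵥ r m‖ ≤ δ) (m : ℕ) :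
    ∀ l, m + l ≤ D → ‖star (s m) ⬝ᵥ s l - if m = l ∧ 1 ≤ m then 1 else 0‖ ≤ 4 ^ m * δ := by
  have hc' : (c : ℂ) ≠ 0 := by exact_mod_cast hc.ne'
  -- Moving `A` across the inner product turns the vector recursion into a recursion for the Gram
  -- matrix, which lowers the first index and raises the second by at most one. This is why the
  -- bound is for `m + l ≤ D`.
  have hG : ∀ m l, star (s (m + 2)) ⬝ᵥ s (l + 1) = star (s (m + 1)) ⬝ᵥ s (l + 2)
      + star (s (m + 1)) ⬝ᵥ s l + star (s (m + 1)) ⬝ᵥ r (l + 1) - star (s m) ⬝ᵥ s (l + 1)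
      - star (r (m + 1)) ⬝ᵥ s (l + 1) := by
    intro m l
    have h : star (A.mulVec (s (m + 1))) ⬝ᵥ s (l + 1)
        = star (s (m + 1)) ⬝ᵥ A.mulVec (s (l + 1)) := by
      rw [Matrix.star_mulVec, hA.eq, Matrix.dotProduct_mulVec]
    rw [hrec, hrec] at h
    simp only [star_smul, smul_dotProduct, dotProduct_smul, star_add, add_dotProduct,
      dotProduct_add, RCLike.star_def, Complex.conj_ofReal, smul_eq_mul] at h
    have := mul_left_cancel₀ hc' h
    linear_combination this
  have hconj : ∀ m l, star (r m) ⬝ᵥ s l = star (star (s l) ⬝ᵥ r m) := by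
    intro m l
    rw [Matrix.star_dotProduct]
  induction m using Nat.strong_induction_on with
  | _ m ih =>
    match m with
    | 0 => intro l _; simpa [hs] using hδ
    | 1 =>
      intro l _
      rw [h1]
      by_cases h : l = 1
      · simp [h]; positivity
      · simp [h, Ne.symm h]; positivity
    | m + 2 =>
      intro l hl
      match l with
      | 0 => simp [hs]; positivity
      | l + 1 =>
        have e1 := ih (m + 1) (by omega) (l + 2) (by omega)
        have e2 := ih (m + 1) (by omega) l (by omega)
        have e3 := ih m (by omega) (l + 1) (by omega)
        have e4 := hr (m + 1) (l + 1) (by omega) (by omega)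
        have e5 := hr (l + 1) (m + 1) (by omega) (by omega)
        rw [← norm_star, ← hconj] at e5
        -- The identity matrix satisfies the same recursion without error, so only differences
        -- propagate.
        have hid : ((if m + 2 = l + 1 ∧ 1 ≤ m + 2 then 1 else 0 : ℂ))
            = (if m + 1 = l + 2 ∧ 1 ≤ m + 1 then 1 else 0)
              + (if m + 1 = l ∧ 1 ≤ m + 1 then 1 else 0)
              - (if m = l + 1 ∧ 1 ≤ m then 1 else 0) := by
          have a1 : (m + 1 = l + 2 ∧ 1 ≤ m + 1) ↔ (m = l + 1 ∧ 1 ≤ m) := by omega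
          have a2 : (m + 2 = l + 1 ∧ 1 ≤ m + 2) ↔ (m + 1 = l ∧ 1 ≤ m + 1) := by omega
          simp only [a1, a2]; ring
        rw [hG, hid]
        set x1 := star (s (m + 1)) ⬝ᵥ s (l + 2) - (if m + 1 = l + 2 ∧ 1 ≤ m + 1 then 1 else 0 : ℂ)
        set x2 := star (s (m + 1)) ⬝ᵥ s l - (if m + 1 = l ∧ 1 ≤ m + 1 then 1 else 0 : ℂ)
        set x3 := star (s m) ⬝ᵥ s (l + 1) - (if m = l + 1 ∧ 1 ≤ m then 1 else 0 : ℂ)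
        calc _ = ‖x1 + x2 - x3 + star (s (m + 1)) ⬝ᵥ r (l + 1)
                - star (r (m + 1)) ⬝ᵥ s (l + 1)‖ := by congr 1; simp only [x1, x2, x3]; ring
          _ ≤ ‖x1‖ + ‖x2‖ + ‖x3‖ + ‖star (s (m + 1)) ⬝ᵥ r (l + 1)‖
                + ‖star (r (m + 1)) ⬝ᵥ s (l + 1)‖ := by
              refine (norm_sub_le _ _).trans (add_le_add_left ?_ _)
              refine (norm_add_le _ _).trans (add_le_add_left ?_ _)
              refine (norm_sub_le _ _).trans (add_le_add_left ?_ _)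
              exact norm_add_le _ _
          _ ≤ 4 ^ (m + 1) * δ + 4 ^ (m + 1) * δ + 4 ^ m * δ + δ + δ := by gcongr
          _ ≤ 4 ^ (m + 2) * δ := by
              have : (1 : ℝ) ≤ 4 ^ m := one_le_pow₀ (by norm_num)
              simp only [pow_succ]
              nlinarith

/-- In the almost orthonormal family, `A / c` acts as the adjacency operator of a path. The test
vector is the sum of the first `d` members: it is doubled by `A / c` except at the two ends of the
path, which cost a bounded amount against a squared norm of about `d`. -/
theorem lambdaMax_ge_of_chebyshev {N : ℕ} {A : Matrix (Fin N) (Fin N) ℂ}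
    (hA : A.IsHermitian) {c δ : ℝ} (hc : 0 < c) (hδ : 0 ≤ δ) (s r : ℕ → Fin N → ℂ) {d : ℕ}
    (hd : 1 ≤ d) (hs : s 0 = 0)
    (hrec : ∀ m, A.mulVec (s (m + 1)) = (c : ℂ) • (s (m + 2) + s m + r (m + 1)))
    (h1 : ∀ m, star (s 1) ⬝ᵥ s m = if m = 1 then 1 else 0)
    (hr : ∀ l m, l ≤ 2 * d + 1 → m ≤ 2 * d + 1 → ‖star (s l) ⬝ᵥ r m‖ ≤ δ)
    (hdδ : (d : ℝ) ^ 2 * 4 ^ d * δ ≤ 1 / 2) :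
    c * (2 - 8 / d) ≤ lambdaMax hA := by
  have hG := norm_dotProduct_sub_le_of_chebyshev hA hc hδ s r (2 * d + 1) hs hrec h1 hr
  have hd' : (1 : ℝ) ≤ d := by exact_mod_cast hd
  set v := ∑ m ∈ Finset.range d, s (m + 1) with hv
  set G : ℕ → ℕ → ℂ := fun m l => star (s m) ⬝ᵥ s l
  have hGm : ∀ m < d, ∀ l ≤ d + 1, ‖G (m + 1) l - if m + 1 = l then 1 else 0‖ ≤ 4 ^ d * δ := by
    intro m hm l hl
    have := hG (m + 1) l (by omega)
    simp only [Nat.le_add_left, and_true] at this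
    refine this.trans ?_
    gcongr
    · norm_num
    · omega
  have hvs : ∀ x, star v ⬝ᵥ x = ∑ m ∈ Finset.range d, star (s (m + 1)) ⬝ᵥ x := by
    intro x
    rw [hv, star_sum, sum_dotProduct]
  set E := (d : ℝ) * (4 ^ d * δ) with hE
  have hpow : (1 : ℝ) ≤ 4 ^ d := one_le_pow₀ (by norm_num)
  have hE0 : 0 ≤ E := by positivity
  have hdE : d * E ≤ 1 / 2 := by rw [hE]; linarith [hdδ]
  have hE1 : E ≤ 1 / 2 := le_trans (by nlinarith) hdE
  have hvl : ∀ l, l ≤ d + 1 →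
      ‖star v ⬝ᵥ s l - if 1 ≤ l ∧ l ≤ d then 1 else 0‖ ≤ E := by
    intro l hl
    have hsum : (if 1 ≤ l ∧ l ≤ d then 1 else 0 : ℂ)
        = ∑ m ∈ Finset.range d, if m + 1 = l then 1 else 0 := by
      rcases Nat.eq_zero_or_pos l with h0 | h0
      · simp [h0]
      · have : ∀ m, (m + 1 = l) ↔ (m = l - 1) := by intro m; omega
        simp only [this, Finset.sum_ite_eq', Finset.mem_range]
        congr 1
        simp only [eq_iff_iff]; omega
    rw [hvs, hsum, ← Finset.sum_sub_distrib]
    refine (norm_sum_le _ _).trans ((Finset.sum_le_sum fun m hm =>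
      hGm m (Finset.mem_range.1 hm) l hl).trans ?_)
    simp [hE]
  have hvv : (d : ℝ) - 1 / 2 ≤ (star v ⬝ᵥ v).re := by
    have h : star v ⬝ᵥ v - d = ∑ l ∈ Finset.range d, (star v ⬝ᵥ s (l + 1) - 1) := by
      conv_lhs => rw [hv, dotProduct_sum, ← hv]
      simp
    have h' : ‖star v ⬝ᵥ v - d‖ ≤ d * E := by
      rw [h]
      refine (norm_sum_le _ _).trans ((Finset.sum_le_sum fun l hl => ?_).trans
        (b := ∑ l ∈ Finset.range d, E) (by simp))
      have hl' := Finset.mem_range.1 hl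
      have := hvl (l + 1) (by omega)
      rwa [if_pos (by omega)] at this
    have := (abs_le.1 ((Complex.abs_re_le_norm _).trans h')).1
    simp only [Complex.sub_re, Complex.natCast_re] at this
    linarith
  -- Summing the recursion shifts the range by one in either direction; only boundary vectors
  -- remain.
  have hAv : A.mulVec v = (c : ℂ) • (v + v + (s (d + 1) - s 1 - s d)
      + ∑ m ∈ Finset.range d, r (m + 1)) := by
    have e1 : ∑ m ∈ Finset.range d, s (m + 2) = v - s 1 + s (d + 1) := by
      have := Finset.sum_range_succ' (fun m => s (m + 1)) d
      rw [Finset.sum_range_succ] at this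
      rw [eq_comm, ← sub_eq_zero] at this ⊢
      rw [← neg_eq_zero, ← this, hv]
      simp only [zero_add, add_assoc, Nat.reduceAdd]
      abel
    have e2 : ∑ m ∈ Finset.range d, s m = v - s d := by
      have := Finset.sum_range_succ' s d
      rw [Finset.sum_range_succ, hs, add_zero] at this
      rw [hv, ← this]; abel
    rw [hv, Matrix.mulVec_sum]
    simp only [hrec, ← Finset.smul_sum, Finset.sum_add_distrib]
    rw [e1, e2]
    congr 1
    abel
  have hrs : ‖star v ⬝ᵥ ∑ m ∈ Finset.range d, r (m + 1)‖ ≤ 1 / 2 := by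
    rw [hvs]
    refine (norm_sum_le _ _).trans ?_
    calc _ ≤ ∑ m ∈ Finset.range d, ∑ l ∈ Finset.range d, δ := by
          refine Finset.sum_le_sum fun m hm => ?_
          rw [dotProduct_sum]
          refine (norm_sum_le _ _).trans (Finset.sum_le_sum fun l hl => hr _ _ ?_ ?_) <;>
          · have := Finset.mem_range.1 hm; have := Finset.mem_range.1 hl; omega
      _ = d * (d * δ) := by simp
      _ ≤ d * E := by rw [hE]; gcongr; nlinarith
      _ ≤ _ := hdE
  -- The loss 4 consists of `E` from `s (d + 1)`, `1 + E` from each of `s 1` and `s d`, and `1 / 2`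
  -- from the errors, with `E ≤ 1 / 2`.
  have hquad : c * (2 * (star v ⬝ᵥ v).re - 4) ≤ (star v ⬝ᵥ A.mulVec v).re := by
    rw [hAv, dotProduct_smul, smul_eq_mul, Complex.re_ofReal_mul]
    refine mul_le_mul_of_nonneg_left ?_ hc.le
    simp only [dotProduct_add, dotProduct_sub, Complex.add_re, Complex.sub_re]
    have a1 := hvl (d + 1) le_rfl
    have a2 := hvl 1 (by omega)
    have a3 := hvl d (by omega)
    rw [if_neg (by omega)] at a1
    rw [if_pos (by omega)] at a2 a3
    have b1 := (abs_le.1 ((Complex.abs_re_le_norm _).trans a1)).1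
    have b2 := (abs_le.1 ((Complex.abs_re_le_norm _).trans a2)).2
    have b3 := (abs_le.1 ((Complex.abs_re_le_norm _).trans a3)).2
    have b4 := (abs_le.1 ((Complex.abs_re_le_norm _).trans hrs)).1
    simp only [Complex.sub_re, Complex.zero_re, Complex.one_re] at b1 b2 b3
    linarith
  have hR := re_dotProduct_mulVec_le_lambdaMax hA v
  have hpos : 0 < (star v ⬝ᵥ v).re := by linarith
  refine le_of_mul_le_mul_right (le_trans ?_ (hquad.trans hR)) hpos
  rw [mul_assoc]
  refine mul_le_mul_of_nonneg_left ?_ hc.le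
  have : 4 ≤ 8 / (d : ℝ) * (star v ⬝ᵥ v).re := by
    rw [div_mul_eq_mul_div, le_div_iff₀ (by linarith)]
    linarith
  linarith

/-! ### The probabilistic model, and independence and moments of products of entries. -/

/-- A Hermitian random matrix with independent centred entries of variance `0` or `1`, at most `W`
of which are nonzero in each row, with the moments of order `k` at most `(C k) ^ (α k)`. -/
structure IsSparseWigner {N : ℕ} {Ω : Type*} [MeasurableSpace Ω] (P : Measure Ω)
    (X : Ω → Matrix (Fin N) (Fin N) ℂ) (W : ℕ) (C α : ℝ) : Prop where
  measurable : ∀ i j, Measurable (fun ω => X ω i j)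
  herm : ∀ ω, (X ω).IsHermitian
  indep : iIndepFun (fun (p : {p : Fin N × Fin N // p.1 ≤ p.2}) (ω : Ω) => X ω p.1.1 p.1.2) P
  row_le : ∀ i, rowCount P X i ≤ W
  mean : ∀ i j, EntryNonzero P X i j → ∫ ω, X ω i j ∂P = 0
  var : ∀ i j, EntryNonzero P X i j → ∫ ω, ‖X ω i j‖ ^ 2 ∂P = 1
  nonneg : 0 ≤ C
  exponent_nonneg : 0 ≤ α
  moment : ∀ i j, ∀ k : ℕ, 2 ≤ k →
    ∫⁻ ω, ‖X ω i j‖ₑ ^ k ∂P ≤ ENNReal.ofReal ((C * k) ^ (α * k))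

/-- The upper triangular entry of `X` at the unordered pair `e`. -/
noncomputable def edgeVar {N : ℕ} {Ω : Type*} (X : Ω → Matrix (Fin N) (Fin N) ℂ)
    (e : Sym2 (Fin N)) (ω : Ω) : ℂ := X ω e.inf e.sup

/-- The σ-algebra generated by the entries of `X` other than those at `e`. -/
@[reducible] noncomputable def sigmaOff {N : ℕ} {Ω : Type*}
    (X : Ω → Matrix (Fin N) (Fin N) ℂ) (e : Sym2 (Fin N)) :
    MeasurableSpace Ω :=
  ⨆ e' ∈ ({e}ᶜ : Set (Sym2 (Fin N))), MeasurableSpace.comap (edgeVar X e') inferInstance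

/-- `Y` is a centred function of the entry at `e` times a function of the other entries. -/
def CenteredAt {N : ℕ} {Ω : Type*} [MeasurableSpace Ω] (P : Measure Ω)
    (X : Ω → Matrix (Fin N) (Fin N) ℂ) (e : Sym2 (Fin N)) (Y : Ω → ℂ) : Prop :=
  ∃ A B : Ω → ℂ, Measurable[MeasurableSpace.comap (edgeVar X e) inferInstance] A ∧
    Measurable[sigmaOff X e] B ∧ ∫ ω, A ω ∂P = 0 ∧ ∀ ω, Y ω = A ω * B ω

/-- The product of the entries of `X` at the positions listed in `L`. -/
noncomputable def entryProd {N : ℕ} {Ω : Type*} (X : Ω → Matrix (Fin N) (Fin N) ℂ)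
    (L : List (Fin N × Fin N)) (ω : Ω) : ℂ := (L.map fun p => X ω p.1 p.2).prod

/-- The unordered pairs listed in `L`. -/
def edgesOf {N : ℕ} (L : List (Fin N × Fin N)) : List (Sym2 (Fin N)) := L.map fun p => s(p.1, p.2)

section

variable {N : ℕ} {Ω : Type*} {X : Ω → Matrix (Fin N) (Fin N) ℂ}

@[simp] theorem entryProd_nil (ω : Ω) : entryProd X [] ω = 1 := rfl

@[simp] theorem entryProd_cons (p : Fin N × Fin N) (L : List (Fin N × Fin N)) (ω : Ω) :
    entryProd X (p :: L) ω = X ω p.1 p.2 * entryProd X L ω := by simp [entryProd]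

@[simp] theorem entryProd_append (L L' : List (Fin N × Fin N)) (ω : Ω) :
    entryProd X (L ++ L') ω = entryProd X L ω * entryProd X L' ω := by simp [entryProd]

theorem enorm_sq_entryProd (L : List (Fin N × Fin N)) (ω : Ω) :
    ‖entryProd X L ω‖ₑ ^ 2 = ‖entryProd X (L ++ L) ω‖ₑ := by
  rw [entryProd_append, enorm_mul, sq]

@[simp] theorem edgesOf_nil : edgesOf ([] : List (Fin N × Fin N)) = [] := rfl

@[simp] theorem edgesOf_cons (p : Fin N × Fin N) (L : List (Fin N × Fin N)) :
    edgesOf (p :: L) = s(p.1, p.2) :: edgesOf L := rfl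

@[simp] theorem edgesOf_append (L L' : List (Fin N × Fin N)) :
    edgesOf (L ++ L') = edgesOf L ++ edgesOf L' := by simp [edgesOf]

theorem Matrix.IsHermitian.eq_edgeVar_or {ω : Ω} (h : (X ω).IsHermitian) (i j : Fin N) :
    X ω i j = edgeVar X s(i, j) ω ∧ i ≤ j ∨ X ω i j = star (edgeVar X s(i, j) ω) ∧ j ≤ i := by
  rcases le_total i j with hij | hij
  · left; simp [edgeVar, hij]
  · right; simp only [edgeVar, Sym2.inf_mk, Sym2.sup_mk, hij, inf_of_le_right, sup_of_le_left]
    exact ⟨(h.apply i j).symm, trivial⟩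

end

namespace IsSparseWigner

variable {N : ℕ} {Ω : Type*} [MeasurableSpace Ω] {P : Measure Ω}
  {X : Ω → Matrix (Fin N) (Fin N) ℂ} {W : ℕ} {C α : ℝ}

theorem enorm_entry (h : IsSparseWigner P X W C α) (i j : Fin N) (ω : Ω) :
    ‖X ω i j‖ₑ = ‖edgeVar X s(i, j) ω‖ₑ := by
  rcases (h.herm ω).eq_edgeVar_or i j with ⟨e, _⟩ | ⟨e, _⟩
  · rw [e]
  · rw [e, ← ofReal_norm, ← ofReal_norm, norm_star]

theorem entryNonzero_comm (h : IsSparseWigner P X W C α) {i j : Fin N}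
    (hij : EntryNonzero P X i j) : EntryNonzero P X j i := by
  intro h'
  refine hij ?_
  filter_upwards [h'] with ω hω
  rw [← (h.herm ω).apply, hω, star_zero]

theorem measurable_edgeVar (h : IsSparseWigner P X W C α) (e : Sym2 (Fin N)) :
    Measurable (edgeVar X e) := h.measurable _ _

theorem iIndepFun_edgeVar (h : IsSparseWigner P X W C α) : iIndepFun (edgeVar X) P :=
  iIndepFun.precomp (g := (Sym2.sortEquiv : Sym2 (Fin N) → {p : Fin N × Fin N // p.1 ≤ p.2}))
    (f := fun p ω => X ω p.1.1 p.1.2) Sym2.sortEquiv.injective h.indep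

theorem measurable_entry_comap (h : IsSparseWigner P X W C α) (i j : Fin N) :
    Measurable[MeasurableSpace.comap (edgeVar X s(i, j)) inferInstance] (fun ω => X ω i j) := by
  have h0 : Measurable[MeasurableSpace.comap (edgeVar X s(i, j)) inferInstance]
      (edgeVar X s(i, j)) := comap_measurable _
  rcases le_total i j with hij | hij
  · have : (fun ω => X ω i j) = edgeVar X s(i, j) := by
      funext ω; simp [edgeVar, hij]
    rw [this]; exact h0
  · have : (fun ω => X ω i j) = fun ω => star (edgeVar X s(i, j) ω) := by
      funext ω
      simp only [edgeVar, Sym2.inf_mk, Sym2.sup_mk, hij, inf_of_le_right, sup_of_le_left]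
      exact ((h.herm ω).apply i j).symm
    rw [this]; exact continuous_star.measurable.comp h0

theorem measurable_entry_sigmaOff (h : IsSparseWigner P X W C α) {e : Sym2 (Fin N)} {i j : Fin N}
    (he : s(i, j) ≠ e) : Measurable[sigmaOff X e] (fun ω => X ω i j) :=
  (h.measurable_entry_comap i j).mono
    (le_iSup₂_of_le (f := fun e' (_ : e' ∈ ({e}ᶜ : Set (Sym2 (Fin N)))) =>
      MeasurableSpace.comap (edgeVar X e') inferInstance) s(i, j) he le_rfl) le_rfl

theorem measurable_entryProd_sigmaOff (h : IsSparseWigner P X W C α) {e : Sym2 (Fin N)}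
    {L : List (Fin N × Fin N)} (he : e ∉ edgesOf L) :
    Measurable[sigmaOff X e] (entryProd X L) := by
  induction L with
  | nil => exact measurable_const
  | cons p L ih =>
    simp only [edgesOf_cons, List.mem_cons, not_or] at he
    have : entryProd X (p :: L) = fun ω => X ω p.1 p.2 * entryProd X L ω := by
      funext ω; simp
    rw [this]
    exact Measurable.mul (h.measurable_entry_sigmaOff (Ne.symm he.1)) (ih he.2)

theorem measurable_entryProd (h : IsSparseWigner P X W C α) (L : List (Fin N × Fin N)) :
    Measurable (entryProd X L) := by
  induction L with
  | nil => exact measurable_const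
  | cons p L ih =>
    have : entryProd X (p :: L) = fun ω => X ω p.1 p.2 * entryProd X L ω := by
      funext ω; simp
    rw [this]
    exact Measurable.mul (h.measurable _ _) ih

theorem integral_centeredAt (h : IsSparseWigner P X W C α) {e : Sym2 (Fin N)} {Y : Ω → ℂ}
    (hY : CenteredAt P X e Y) : ∫ ω, Y ω ∂P = 0 := by
  obtain ⟨A, B, hA, hB, hA0, hAB⟩ := hY
  have hle : ∀ e', MeasurableSpace.comap (edgeVar X e') inferInstance ≤ ‹MeasurableSpace Ω› :=
    fun e' => (h.measurable_edgeVar e').comap_le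
  have hind := indep_iSup_of_disjoint hle h.iIndepFun_edgeVar.iIndep
    (S := {e}) (T := {e}ᶜ) disjoint_compl_right
  have hAB' : IndepFun A B P := by
    rw [IndepFun_iff_Indep]
    refine indep_of_indep_of_le_left (indep_of_indep_of_le_right hind hB.comap_le) ?_
    simpa using hA.comap_le
  have hoff : sigmaOff X e ≤ ‹MeasurableSpace Ω› := iSup₂_le fun e' _ => hle e'
  simp only [hAB]
  rw [hAB'.integral_fun_mul_eq_mul_integral (hA.mono (hle e) le_rfl).aestronglyMeasurable
    (hB.mono hoff le_rfl).aestronglyMeasurable, hA0, zero_mul]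

theorem _root_.CenteredAt.mul {e : Sym2 (Fin N)} {Y Z : Ω → ℂ} (hY : CenteredAt P X e Y)
    (hZ : Measurable[sigmaOff X e] Z) : CenteredAt P X e (fun ω => Y ω * Z ω) := by
  obtain ⟨A, B, hA, hB, hA0, hAB⟩ := hY
  exact ⟨A, fun ω => B ω * Z ω, hA, Measurable.mul hB hZ, hA0, fun ω => by simp only [hAB, mul_assoc]⟩

theorem integral_entry (h : IsSparseWigner P X W C α) (i j : Fin N) : ∫ ω, X ω i j ∂P = 0 := by
  by_cases hij : EntryNonzero P X i j
  · exact h.mean i j hij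
  · rw [EntryNonzero, not_not] at hij
    rw [integral_congr_ae hij, integral_zero]

theorem centeredAt_entryProd (h : IsSparseWigner P X W C α) {L : List (Fin N × Fin N)}
    {e : Sym2 (Fin N)} (he : (edgesOf L).count e = 1) : CenteredAt P X e (entryProd X L) := by
  have hmem : e ∈ edgesOf L := List.count_pos_iff.1 (by omega)
  obtain ⟨p, hp, hpe⟩ := List.mem_map.1 hmem
  obtain ⟨L1, L2, rfl⟩ := List.append_of_mem hp
  subst hpe
  simp only [edgesOf_append, edgesOf_cons, List.count_append, List.count_cons_self] at he
  have h12 : s(p.1, p.2) ∉ edgesOf (L1 ++ L2) := by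
    rw [← List.count_eq_zero, edgesOf_append, List.count_append]; omega
  refine ⟨_, _, h.measurable_entry_comap p.1 p.2, h.measurable_entryProd_sigmaOff h12,
    h.integral_entry p.1 p.2, fun ω => ?_⟩
  simp only [entryProd_append, entryProd_cons]
  ring

/-- The modulus of an entry depends only on the unordered pair, so absolute moments factor over
pairs according to multiplicity. -/
theorem lintegral_entryProd (h : IsSparseWigner P X W C α) (L : List (Fin N × Fin N)) :
    ∫⁻ ω, ‖entryProd X L ω‖ₑ ∂P
      = ∏ e, ∫⁻ ω, ‖edgeVar X e ω‖ₑ ^ (edgesOf L).count e ∂P := by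
  have h1 : ∀ ω, ‖entryProd X L ω‖ₑ = ∏ e, ‖edgeVar X e ω‖ₑ ^ (edgesOf L).count e := by
    intro ω
    induction L with
    | nil => simp
    | cons p L ih =>
      rw [entryProd_cons, enorm_mul, ih, h.enorm_entry]
      simp only [edgesOf_cons, List.count_cons, pow_add, Finset.prod_mul_distrib]
      rw [mul_comm]
      congr 1
      rw [Finset.prod_eq_single s(p.1, p.2)]
      · simp
      · intro b _ hb; simp [Ne.symm hb]
      · simp
  simp only [h1]
  refine lintegral_prod_eq_prod_lintegral_of_indepFun Finset.univ
    (fun e ω => ‖edgeVar X e ω‖ₑ ^ (edgesOf L).count e) ?_ ?_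
  · exact h.iIndepFun_edgeVar.comp (fun e z => ‖z‖ₑ ^ (edgesOf L).count e)
      (fun e => measurable_enorm.pow_const _)
  · exact fun e => (h.measurable_edgeVar e).enorm.pow_const _

theorem lintegral_edgeVar_pow_le (h : IsSparseWigner P X W C α) (e : Sym2 (Fin N)) {k : ℕ}
    (hk : 2 ≤ k) : ∫⁻ ω, ‖edgeVar X e ω‖ₑ ^ k ∂P ≤ ENNReal.ofReal ((C * k) ^ (α * k)) :=
  h.moment _ _ k hk

theorem lintegral_edgeVar_sq_le (h : IsSparseWigner P X W C α) (e : Sym2 (Fin N)) :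
    ∫⁻ ω, ‖edgeVar X e ω‖ₑ ^ 2 ∂P ≤ 1 := by
  by_cases he : EntryNonzero P X e.inf e.sup
  · have hv := h.var _ _ he
    have hi : Integrable (fun ω => ‖X ω e.inf e.sup‖ ^ 2) P := by
      by_contra hc
      rw [integral_undef hc] at hv
      exact zero_ne_one hv
    have := ofReal_integral_eq_lintegral_ofReal hi (Eventually.of_forall fun ω => by positivity)
    rw [hv, ENNReal.ofReal_one] at this
    rw [this]
    refine le_of_eq (lintegral_congr fun ω => ?_)
    rw [edgeVar, ENNReal.ofReal_pow (norm_nonneg _), ofReal_norm]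
  · rw [EntryNonzero, not_not] at he
    have : ∀ᵐ ω ∂P, ‖edgeVar X e ω‖ₑ ^ 2 = 0 := by
      filter_upwards [he] with ω hω
      simp [edgeVar, hω]
    rw [lintegral_congr_ae this]
    simp

theorem lintegral_edgeVar_pow_lt_top [IsProbabilityMeasure P] (h : IsSparseWigner P X W C α)
    (e : Sym2 (Fin N)) (k : ℕ) : ∫⁻ ω, ‖edgeVar X e ω‖ₑ ^ k ∂P < ⊤ := by
  rcases Nat.lt_or_ge k 2 with hk | hk
  -- The moment hypothesis starts at order two; lower orders are dominated by the second.
  · have : ∀ ω, ‖edgeVar X e ω‖ₑ ^ k ≤ 1 + ‖edgeVar X e ω‖ₑ ^ 2 := by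
      intro ω
      rcases le_total ‖edgeVar X e ω‖ₑ 1 with h1 | h1
      · exact (pow_le_one₀ (zero_le) h1).trans (le_add_right le_rfl)
      · exact (pow_le_pow_right₀ h1 hk.le).trans (le_add_left le_rfl)
    refine (lintegral_mono this).trans_lt ?_
    rw [lintegral_add_left measurable_const]
    refine ENNReal.add_lt_top.2 ⟨by simp, (h.lintegral_edgeVar_sq_le e).trans_lt (by simp)⟩
  · exact (h.lintegral_edgeVar_pow_le e hk).trans_lt ENNReal.ofReal_lt_top

theorem integrable_entryProd [IsProbabilityMeasure P] (h : IsSparseWigner P X W C α)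
    (L : List (Fin N × Fin N)) : Integrable (entryProd X L) P := by
  refine ⟨(h.measurable_entryProd L).aestronglyMeasurable, ?_⟩
  rw [hasFiniteIntegral_iff_enorm, h.lintegral_entryProd]
  exact ENNReal.prod_lt_top fun e _ => h.lintegral_edgeVar_pow_lt_top e _

theorem lintegral_entryProd_eq_zero (h : IsSparseWigner P X W C α) {L : List (Fin N × Fin N)}
    {p : Fin N × Fin N} (hp : p ∈ L) (hp0 : ¬ EntryNonzero P X p.1 p.2) :
    ∫⁻ ω, ‖entryProd X L ω‖ₑ ∂P = 0 := by
  rw [EntryNonzero, not_not] at hp0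
  rw [lintegral_eq_zero_iff (h.measurable_entryProd L).enorm]
  filter_upwards [hp0] with ω hω
  have : entryProd X L ω = 0 :=
    List.prod_eq_zero (List.mem_map.2 ⟨p, hp, hω⟩)
  simp [this]

end IsSparseWigner

/-! ### The potential of a partial walk and its growth in one step. -/

section Potential

variable {N : ℕ}

/-- The number of pairs at `x` listed exactly once in `E`. -/
def openDeg (E : List (Sym2 (Fin N))) (x : Fin N) : ℕ :=
  (Finset.univ.filter fun y => E.count s(x, y) = 1).card

/-- The number of pairs listed exactly once in `E`. -/
def numOpen (E : List (Sym2 (Fin N))) : ℕ :=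
  (Finset.univ.filter fun e => E.count e = 1).card

/-- The excess of the open degrees over their values `1` at the current vertex `v` and `2` elsewhere
in a walk which explores a tree depth first. -/
def excess (E : List (Sym2 (Fin N))) (v : Fin N) : ℕ :=
  ∑ x, if x = v then openDeg E x - 1 else openDeg E x - 2

/-- Serves both `openDeg`, with `f` sending a vertex to its pair with a fixed one, and `numOpen`,
with `f` the identity. -/
theorem card_filter_count_cons {β : Type*} [Fintype β] [DecidableEq β] {γ : Type*} [DecidableEq γ]
    (E : List γ) (f : β → γ) (hf : f.Injective) (b : β) :
    (E.count (f b) = 0 → (Finset.univ.filter fun y => (f b :: E).count (f y) = 1).card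
        = (Finset.univ.filter fun y => E.count (f y) = 1).card + 1) ∧
    (E.count (f b) = 1 → (Finset.univ.filter fun y => (f b :: E).count (f y) = 1).card + 1
        = (Finset.univ.filter fun y => E.count (f y) = 1).card) ∧
    (2 ≤ E.count (f b) → (Finset.univ.filter fun y => (f b :: E).count (f y) = 1).card
        = (Finset.univ.filter fun y => E.count (f y) = 1).card) := by
  have hc : ∀ y, (f b :: E).count (f y) = E.count (f y) + if y = b then 1 else 0 := by
    intro y
    rw [List.count_cons]
    congr 1
    by_cases hy : y = b
    · simp [hy]
    · have h' : ¬ f b = f y := fun h' => hy (hf h').symm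
      simp [hy, h']
  refine ⟨fun h => ?_, fun h => ?_, fun h => ?_⟩
  · rw [← Finset.card_insert_of_notMem (a := b) (by simp [h])]
    congr 1
    ext y
    simp only [Finset.mem_filter, Finset.mem_univ, true_and, Finset.mem_insert, hc]
    by_cases hy : y = b
    · simp [hy, h]
    · simp [hy]
  · rw [← Finset.card_insert_of_notMem (a := b) (by simp [h])]
    congr 1
    ext y
    simp only [Finset.mem_filter, Finset.mem_univ, true_and, Finset.mem_insert, hc]
    by_cases hy : y = b
    · simp [hy, h]
    · simp [hy]
  · congr 1
    ext y
    simp only [Finset.mem_filter, Finset.mem_univ, true_and, hc]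
    by_cases hy : y = b
    · simp only [hy, if_true]; omega
    · simp [hy]

theorem openDeg_cons (E : List (Sym2 (Fin N))) (u v : Fin N) :
    (E.count s(u, v) = 0 → openDeg (s(u, v) :: E) v = openDeg E v + 1) ∧
    (E.count s(u, v) = 1 → openDeg (s(u, v) :: E) v + 1 = openDeg E v) ∧
    (2 ≤ E.count s(u, v) → openDeg (s(u, v) :: E) v = openDeg E v) := by
  have := card_filter_count_cons E (fun y => s(v, y)) (fun a b h => Sym2.congr_right.1 h) u
  simpa only [openDeg, Sym2.eq_swap (a := u)] using this

theorem openDeg_cons' (E : List (Sym2 (Fin N))) (u v : Fin N) :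
    (E.count s(u, v) = 0 → openDeg (s(u, v) :: E) u = openDeg E u + 1) ∧
    (E.count s(u, v) = 1 → openDeg (s(u, v) :: E) u + 1 = openDeg E u) ∧
    (2 ≤ E.count s(u, v) → openDeg (s(u, v) :: E) u = openDeg E u) := by
  rw [Sym2.eq_swap]
  exact openDeg_cons E v u

theorem openDeg_cons_of_ne (E : List (Sym2 (Fin N))) {u v x : Fin N} (hu : x ≠ u) (hv : x ≠ v) :
    openDeg (s(u, v) :: E) x = openDeg E x := by
  rw [openDeg, openDeg]
  congr 1
  ext y
  have : s(u, v) ≠ s(x, y) := by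
    intro h
    rcases Sym2.eq_iff.1 h with ⟨h1, _⟩ | ⟨_, h1⟩
    · exact hu h1.symm
    · exact hv h1.symm
  simp [List.count_cons_of_ne this]

theorem numOpen_cons (E : List (Sym2 (Fin N))) (e : Sym2 (Fin N)) :
    (E.count e = 0 → numOpen (e :: E) = numOpen E + 1) ∧
    (E.count e = 1 → numOpen (e :: E) + 1 = numOpen E) ∧
    (2 ≤ E.count e → numOpen (e :: E) = numOpen E) :=
  card_filter_count_cons E id Function.injective_id e

theorem excess_cons_self (E : List (Sym2 (Fin N))) (v : Fin N) :
    excess (s(v, v) :: E) v + (openDeg E v - 1)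
      = excess E v + (openDeg (s(v, v) :: E) v - 1) := by
  simp only [excess]
  rw [← Finset.add_sum_erase _ _ (Finset.mem_univ v),
    ← Finset.add_sum_erase (a := v) _ (fun x => if x = v then openDeg E x - 1 else _)
      (Finset.mem_univ v)]
  have : ∀ x ∈ Finset.univ.erase v,
      (if x = v then openDeg (s(v, v) :: E) x - 1 else openDeg (s(v, v) :: E) x - 2)
        = if x = v then openDeg E x - 1 else openDeg E x - 2 := by
    intro x hx
    have hx' := (Finset.mem_erase.1 hx).1
    rw [openDeg_cons_of_ne E hx' hx']
  rw [Finset.sum_congr rfl this]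
  simp only [if_true]
  omega

/-- Only the terms at `u` and `v` change: the allowance 1 moves from `v` to `u`. The identity is
written additively because of truncated subtraction. -/
theorem excess_cons_of_ne (E : List (Sym2 (Fin N))) {u v : Fin N} (huv : u ≠ v) :
    excess (s(u, v) :: E) u + (openDeg E u - 2) + (openDeg E v - 1)
      = excess E v + (openDeg (s(u, v) :: E) u - 1) + (openDeg (s(u, v) :: E) v - 2) := by
  simp only [excess]
  have hv : v ∈ (Finset.univ : Finset (Fin N)).erase u :=
    Finset.mem_erase.2 ⟨huv.symm, Finset.mem_univ _⟩
  rw [← Finset.add_sum_erase _ _ (Finset.mem_univ u), ← Finset.add_sum_erase _ _ hv,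
    ← Finset.add_sum_erase (a := u) _ (fun x => if x = v then openDeg E x - 1 else _)
      (Finset.mem_univ u),
    ← Finset.add_sum_erase (a := v) _ (fun x => if x = v then openDeg E x - 1 else _) hv]
  have : ∀ x ∈ (Finset.univ.erase u).erase v,
      (if x = u then openDeg (s(u, v) :: E) x - 1 else openDeg (s(u, v) :: E) x - 2)
        = if x = v then openDeg E x - 1 else openDeg E x - 2 := by
    intro x hx
    simp only [Finset.mem_erase, Finset.mem_univ, and_true] at hx
    rw [openDeg_cons_of_ne E hx.2 hx.1, if_neg hx.2, if_neg hx.1]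
  rw [Finset.sum_congr rfl this]
  simp only [if_true, huv, huv.symm, if_false]
  omega

/-- At the vertex left, both open degree and allowance rise by one. At the vertex reached, the open
degree rises and the allowance falls, at no cost if nothing was open there. -/
theorem excess_cons_of_count_eq_zero {E : List (Sym2 (Fin N))} {u v : Fin N}
    (hc : E.count s(u, v) = 0) : excess (s(u, v) :: E) u ≤ excess E v + 2 ∧
      (openDeg E u = 0 → excess (s(u, v) :: E) u ≤ excess E v) := by
  have h1 := (openDeg_cons E u v).1 hc
  have h2 := (openDeg_cons' E u v).1 hc
  rcases eq_or_ne u v with rfl | huv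
  · have := excess_cons_self E u
    omega
  · have := excess_cons_of_ne E huv
    omega

/-- In a depth-first exploration there is a single open edge to return along. With several, the
excess drops, and the factor `M` released pays for the choice among them. -/
theorem excess_cons_of_count_eq_one {E : List (Sym2 (Fin N))} {u v : Fin N}
    (hc : E.count s(u, v) = 1) : 1 ≤ openDeg E v ∧ excess (s(u, v) :: E) u ≤ excess E v ∧
      (2 ≤ openDeg E v → excess (s(u, v) :: E) u + 1 ≤ excess E v) := by
  have h1 := (openDeg_cons E u v).2.1 hc
  have h2 := (openDeg_cons' E u v).2.1 hc
  rcases eq_or_ne u v with rfl | huv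
  · have := excess_cons_self E u
    omega
  · have := excess_cons_of_ne E huv
    omega

theorem excess_cons_of_two_le_count {E : List (Sym2 (Fin N))} {u v : Fin N}
    (hc : 2 ≤ E.count s(u, v)) : excess (s(u, v) :: E) u ≤ excess E v + 1 := by
  have h1 := (openDeg_cons E u v).2.2 hc
  have h2 := (openDeg_cons' E u v).2.2 hc
  rcases eq_or_ne u v with rfl | huv
  · have := excess_cons_self E u
    omega
  · have := excess_cons_of_ne E huv
    omega

/-- The product of `K ^ (m - 2)` over the pairs of multiplicity `m ≥ 2` in `E`. -/
noncomputable def excessWeight (K : ℝ) (E : List (Sym2 (Fin N))) : ℝ := ∏ e, K ^ (E.count e - 2)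

theorem excessWeight_nonneg {K : ℝ} (hK : 0 ≤ K) (E : List (Sym2 (Fin N))) :
    0 ≤ excessWeight K E := Finset.prod_nonneg fun _ _ => by positivity

theorem excessWeight_cons (K : ℝ) (E : List (Sym2 (Fin N))) (e : Sym2 (Fin N)) :
    excessWeight K (e :: E) = (if 2 ≤ E.count e then K else 1) * excessWeight K E := by
  simp only [excessWeight]
  rw [← Finset.mul_prod_erase _ _ (Finset.mem_univ e),
    ← Finset.mul_prod_erase _ (fun x => K ^ (E.count x - 2)) (Finset.mem_univ e), ← mul_assoc]
  congr 1
  · rw [List.count_cons_self]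
    split_ifs with h
    · rw [show E.count e + 1 - 2 = (E.count e - 2) + 1 by omega, pow_succ]; ring
    · rw [show E.count e + 1 - 2 = 0 by omega, show E.count e - 2 = 0 by omega]; simp
  · refine Finset.prod_congr rfl fun x hx => ?_
    rw [List.count_cons_of_ne (Finset.mem_erase.1 hx).1.symm]

/-- The weight of a walk with edge list `E` and endpoint `v`, which bounds the total contribution of
its continuations. -/
noncomputable def potential (K γ : ℝ) (M : ℕ) (E : List (Sym2 (Fin N))) (v : Fin N) : ℝ :=
  excessWeight K E * (M : ℝ) ^ excess E v * (γ⁻¹) ^ numOpen E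

theorem potential_nonneg {K γ : ℝ} (hK : 0 ≤ K) (hγ : 0 ≤ γ) (M : ℕ) (E : List (Sym2 (Fin N)))
    (v : Fin N) : 0 ≤ potential K γ M E v := by
  have := excessWeight_nonneg hK E
  unfold potential; positivity

/-- `S` contains the visited vertices. The four summands are the prices of opening an edge towards a
vertex without open edges, opening one towards a vertex with open edges, closing an edge, and
reusing an edge already traversed twice. -/
theorem potential_cons_le {K γ : ℝ} (hK : 0 ≤ K) (hγ : 0 < γ) {M : ℕ} (hM : 1 ≤ M)
    (E : List (Sym2 (Fin N))) (u v : Fin N) (S : Finset (Fin N)) (hSM : S.card ≤ M)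
    (hS : ∀ x y, s(x, y) ∈ E → x ∈ S) :
    potential K γ M (s(u, v) :: E) u ≤ potential K γ M E v *
      (γ⁻¹ + (if u ∈ S then M ^ 2 * γ⁻¹ else 0)
        + (if E.count s(u, v) = 1 then γ / openDeg E v else 0) + (if u ∈ S then M * K else 0)) := by
  have hM' : (1 : ℝ) ≤ M := by exact_mod_cast hM
  have hE := excessWeight_nonneg hK E
  have hdeg : openDeg E v ≤ M := by
    refine (Finset.card_le_card fun y hy => ?_).trans hSM
    have hy' : E.count s(v, y) = 1 := (Finset.mem_filter.1 hy).2
    refine hS y v ?_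
    rw [Sym2.eq_swap]
    exact List.count_pos_iff.1 (by omega)
  set R := potential K γ M E v with hR
  have hR0 : 0 ≤ R := potential_nonneg hK hγ.le _ _ _
  have i1 : (0 : ℝ) ≤ γ⁻¹ := by positivity
  have i2 : (0 : ℝ) ≤ if u ∈ S then (M : ℝ) ^ 2 * γ⁻¹ else 0 := by split_ifs <;> positivity
  have i3 : (0 : ℝ) ≤ if E.count s(u, v) = 1 then γ / openDeg E v else 0 := by
    split_ifs <;> positivity
  have i4 : (0 : ℝ) ≤ if u ∈ S then M * K else 0 := by split_ifs <;> positivity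
  have key : ∀ t : ℝ, potential K γ M (s(u, v) :: E) u ≤ R * t →
      t ≤ γ⁻¹ + (if u ∈ S then M ^ 2 * γ⁻¹ else 0)
        + (if E.count s(u, v) = 1 then γ / openDeg E v else 0) + (if u ∈ S then M * K else 0) →
      potential K γ M (s(u, v) :: E) u ≤ R * (γ⁻¹ + (if u ∈ S then M ^ 2 * γ⁻¹ else 0)
        + (if E.count s(u, v) = 1 then γ / openDeg E v else 0)
        + (if u ∈ S then M * K else 0)) :=
    fun t h1 h2 => h1.trans (mul_le_mul_of_nonneg_left h2 hR0)
  rcases Nat.lt_trichotomy (E.count s(u, v)) 1 with hc | hc | hc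
  · have hc0 : E.count s(u, v) = 0 := by omega
    have hw : excessWeight K (s(u, v) :: E) = excessWeight K E := by
      rw [excessWeight_cons, if_neg (by omega), one_mul]
    obtain ⟨x2, x0⟩ := excess_cons_of_count_eq_zero hc0
    by_cases hu : openDeg E u = 0
    · refine key γ⁻¹ ?_ (by linarith)
      rw [hR, potential, potential, hw, (numOpen_cons E _).1 hc0, pow_succ, ← mul_assoc]
      gcongr
      exacts [x0 hu]
    · have huS : u ∈ S := by
        obtain ⟨y, hy⟩ := Finset.card_pos.1 (Nat.pos_of_ne_zero hu)
        have hy' : E.count s(u, y) = 1 := (Finset.mem_filter.1 hy).2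
        exact hS u y (List.count_pos_iff.1 (by omega))
      simp only [if_pos huS] at i2 i4 key ⊢
      refine key (M ^ 2 * γ⁻¹) ?_ (by linarith)
      rw [hR, potential, potential, hw, (numOpen_cons E _).1 hc0, pow_succ,
        show excessWeight K E * (M : ℝ) ^ excess E v * γ⁻¹ ^ numOpen E * ((M : ℝ) ^ 2 * γ⁻¹)
          = excessWeight K E * (M : ℝ) ^ (excess E v + 2) * (γ⁻¹ ^ numOpen E * γ⁻¹) by ring]
      gcongr
  · have hw : excessWeight K (s(u, v) :: E) = excessWeight K E := by
      rw [excessWeight_cons, if_neg (by omega), one_mul]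
    obtain ⟨x1, x0, x2⟩ := excess_cons_of_count_eq_one hc
    have hd : (1 : ℝ) ≤ openDeg E v := by exact_mod_cast x1
    simp only [if_pos hc] at i3 key ⊢
    refine key (γ / openDeg E v) ?_ (by linarith)
    -- The drop of the excess supplies the denominator `openDeg E v ≤ M`, which makes the closing
    -- steps cost `γ` in total.
    have hpow : (M : ℝ) ^ excess (s(u, v) :: E) u * openDeg E v ≤ (M : ℝ) ^ excess E v := by
      rcases Nat.lt_or_ge (openDeg E v) 2 with h2 | h2
      · rw [show openDeg E v = 1 by omega, Nat.cast_one, mul_one]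
        exact pow_le_pow_right₀ hM' x0
      · calc _ ≤ (M : ℝ) ^ excess (s(u, v) :: E) u * M := by gcongr
          _ = (M : ℝ) ^ (excess (s(u, v) :: E) u + 1) := by rw [pow_succ]
          _ ≤ _ := pow_le_pow_right₀ hM' (x2 h2)
    rw [hR, potential, potential, hw, ← (numOpen_cons E _).2.1 hc, pow_succ,
      show excessWeight K E * (M : ℝ) ^ excess E v * (γ⁻¹ ^ numOpen (s(u, v) :: E) * γ⁻¹)
          * (γ / openDeg E v)
        = excessWeight K E * ((M : ℝ) ^ excess E v / openDeg E v) * γ⁻¹ ^ numOpen (s(u, v) :: E)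
          * (γ⁻¹ * γ) by ring, inv_mul_cancel₀ hγ.ne', mul_one]
    gcongr
    rwa [le_div_iff₀ (by linarith)]
  · have hc2 : 2 ≤ E.count s(u, v) := hc
    have hw : excessWeight K (s(u, v) :: E) = K * excessWeight K E := by
      rw [excessWeight_cons, if_pos hc2]
    have huS : u ∈ S := hS u v (List.count_pos_iff.1 (by omega))
    simp only [if_pos huS] at i2 i4 key ⊢
    refine key (M * K) ?_ (by linarith)
    rw [hR, potential, potential, hw, (numOpen_cons E _).2.2 hc2,
      show excessWeight K E * (M : ℝ) ^ excess E v * γ⁻¹ ^ numOpen E * (M * K)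
        = K * excessWeight K E * (M : ℝ) ^ (excess E v + 1) * γ⁻¹ ^ numOpen E by ring]
    gcongr
    exact excess_cons_of_two_le_count hc2

/-- Opening steps contribute at most `W / γ + M ^ 3 / γ`, closing steps at most `γ`, reuse at most
`M ^ 2 * K`. The choice of `γ` equates the first two bounds. -/
theorem sum_potential_cons_le {K γ : ℝ} (hK : 0 ≤ K) (hγ : 0 < γ) {M W : ℕ} (hM : 1 ≤ M)
    (hγW : γ ^ 2 = W + M ^ 3) (E : List (Sym2 (Fin N))) (v : Fin N) (S T : Finset (Fin N))
    (hSM : S.card ≤ M) (hS : ∀ x y, s(x, y) ∈ E → x ∈ S) (hT : T.card ≤ W) :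
    ∑ u ∈ T, potential K γ M (s(u, v) :: E) u ≤ (2 * γ + M ^ 2 * K) * potential K γ M E v := by
  refine (Finset.sum_le_sum fun u _ => potential_cons_le hK hγ hM E u v S hSM hS).trans ?_
  rw [← Finset.mul_sum, mul_comm]
  refine mul_le_mul_of_nonneg_right ?_ (potential_nonneg hK hγ.le _ _ _)
  simp only [Finset.sum_add_distrib]
  have hsub : ∀ a : ℝ, 0 ≤ a → ∑ u ∈ T, (if u ∈ S then a else 0) ≤ M * a := by
    intro a ha
    rw [← Finset.sum_filter, Finset.sum_const, nsmul_eq_mul]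
    refine mul_le_mul_of_nonneg_right ?_ ha
    refine Nat.cast_le.2 ((Finset.card_le_card fun x hx => ?_).trans hSM)
    exact (Finset.mem_filter.1 hx).2
  have e1 : ∑ u ∈ T, γ⁻¹ ≤ W * γ⁻¹ := by
    rw [Finset.sum_const, nsmul_eq_mul]
    gcongr
  have e2 := hsub (M ^ 2 * γ⁻¹) (by positivity)
  have e4 := hsub (M * K) (by positivity)
  have e3 : ∑ u ∈ T, (if E.count s(u, v) = 1 then γ / openDeg E v else 0) ≤ γ := by
    rw [← Finset.sum_filter, Finset.sum_const, nsmul_eq_mul]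
    have hcard : (T.filter fun u => E.count s(u, v) = 1).card ≤ openDeg E v := by
      refine Finset.card_le_card fun y hy => ?_
      rw [Finset.mem_filter] at hy ⊢
      exact ⟨Finset.mem_univ _, by rw [Sym2.eq_swap]; exact hy.2⟩
    rcases Nat.eq_zero_or_pos (openDeg E v) with h0 | h0
    · rw [h0]; simp [hγ.le]
    · have h0' : (0 : ℝ) < openDeg E v := by exact_mod_cast h0
      rw [mul_div_assoc', div_le_iff₀ h0', mul_comm]
      gcongr
  have e5 : (W : ℝ) * γ⁻¹ + M * (M ^ 2 * γ⁻¹) = γ := by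
    field_simp
    linarith
  nlinarith
end Potential

/-! ### Walks and the entries of matrix powers. -/

section Walks

variable {N : ℕ}

/-- The steps of a walk, listed as pairs (new vertex, old vertex); a walk is the list of its vertices
in reverse order. -/
def stepsOf (h : List (Fin N)) : List (Fin N × Fin N) := h.zip h.tail

/-- The walks of length `n` from `i`. -/
def walks (i : Fin N) : ℕ → Finset (List (Fin N))
  | 0 => {[i]}
  | n + 1 => (Finset.univ ×ˢ walks i n).map
      ⟨fun p => p.1 :: p.2, fun p q h => by
        simp only [List.cons.injEq] at h; exact Prod.ext h.1 h.2⟩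

@[simp] theorem stepsOf_singleton (i : Fin N) : stepsOf [i] = [] := rfl

@[simp] theorem stepsOf_cons_cons (u v : Fin N) (t : List (Fin N)) :
    stepsOf (u :: v :: t) = (u, v) :: stepsOf (v :: t) := rfl

theorem mem_walks_succ {i : Fin N} {n : ℕ} {h : List (Fin N)} :
    h ∈ walks i (n + 1) ↔ ∃ u, ∃ t ∈ walks i n, u :: t = h := by
  rw [walks, Finset.mem_map]
  constructor
  · rintro ⟨⟨u, t⟩, ht, rfl⟩
    exact ⟨u, t, (Finset.mem_product.1 ht).2, rfl⟩
  · rintro ⟨u, t, ht, rfl⟩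
    exact ⟨(u, t), Finset.mem_product.2 ⟨Finset.mem_univ _, ht⟩, rfl⟩

theorem sum_walks_succ {β : Type*} [AddCommMonoid β] (i : Fin N) (n : ℕ) (f : List (Fin N) → β) :
    ∑ h ∈ walks i (n + 1), f h = ∑ h ∈ walks i n, ∑ u, f (u :: h) := by
  rw [walks, Finset.sum_map, Finset.sum_product_right]
  rfl

theorem length_of_mem_walks {i : Fin N} {n : ℕ} : ∀ {h}, h ∈ walks i n → h.length = n + 1 := by
  induction n with
  | zero => intro h hh; simp [walks] at hh; simp [hh]
  | succ n ih =>
    intro h hh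
    obtain ⟨u, t, ht, rfl⟩ := mem_walks_succ.1 hh
    simp [ih ht]

theorem exists_cons_of_mem_walks {i : Fin N} {n : ℕ} {h : List (Fin N)} (hh : h ∈ walks i n) :
    ∃ v t, h = v :: t :=
  List.exists_cons_of_length_pos (by rw [length_of_mem_walks hh]; omega)

theorem stepsOf_cons_of_mem_walks {i : Fin N} {n : ℕ} {h : List (Fin N)} (hh : h ∈ walks i n)
    (u : Fin N) : stepsOf (u :: h) = (u, h.headD i) :: stepsOf h := by
  obtain ⟨v, t, rfl⟩ := exists_cons_of_mem_walks hh
  rfl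

theorem mem_of_mem_edgesOf_stepsOf {h : List (Fin N)} {x y : Fin N}
    (he : s(x, y) ∈ edgesOf (stepsOf h)) : x ∈ h ∧ y ∈ h := by
  obtain ⟨⟨a, b⟩, hp, hpe⟩ := List.mem_map.1 he
  obtain ⟨h1, h2⟩ := List.of_mem_zip hp
  have h2' := List.mem_of_mem_tail h2
  rcases Sym2.eq_iff.1 hpe with ⟨rfl, rfl⟩ | ⟨rfl, rfl⟩
  · exact ⟨h1, h2'⟩
  · exact ⟨h2', h1⟩

theorem Matrix.pow_apply_eq_sum_walks (A : Matrix (Fin N) (Fin N) ℂ) (i : Fin N) (n : ℕ) :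
    ∀ j, (A ^ n) j i = ∑ h ∈ walks i n,
      if h.headD i = j then ((stepsOf h).map fun p => A p.1 p.2).prod else 0 := by
  induction n with
  | zero => intro j; simp [walks, Matrix.one_apply, eq_comm]
  | succ n ih =>
    intro j
    rw [pow_succ', Matrix.mul_apply, sum_walks_succ]
    simp only [ih, Finset.mul_sum]
    rw [Finset.sum_comm]
    refine Finset.sum_congr rfl fun h hh => ?_
    rw [Finset.sum_eq_single (h.headD i), Finset.sum_eq_single j]
    · simp [stepsOf_cons_of_mem_walks hh]
    · intro b _ hb; simp [hb]
    · simp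
    · intro b _ hb; rw [if_neg (Ne.symm hb), mul_zero]
    · simp

end Walks

/-! ### Expected traces of powers and the upper tail. -/

namespace IsSparseWigner

variable {N : ℕ} {Ω : Type*} [MeasurableSpace Ω] {P : Measure Ω}
  {X : Ω → Matrix (Fin N) (Fin N) ℂ} {W : ℕ} {C α : ℝ}

open Classical in
theorem card_filter_entryNonzero_le (h : IsSparseWigner P X W C α) (v : Fin N) :
    (Finset.univ.filter fun u => EntryNonzero P X u v).card ≤ W := by
  refine le_trans (le_of_eq ?_) (h.row_le v)
  rw [rowCount, Set.ncard_eq_toFinset_card']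
  congr 1
  ext u
  simp only [Finset.mem_filter, Finset.mem_univ, true_and, Set.mem_toFinset, Set.mem_ofPred_eq]
  exact ⟨h.entryNonzero_comm, h.entryNonzero_comm⟩

open Classical in
/-- The potential of a walk along nonzero entries, and `0` for the other walks. -/
noncomputable def walkPotential (P : Measure Ω) (X : Ω → Matrix (Fin N) (Fin N) ℂ)
    (K γ : ℝ) (M : ℕ) (i : Fin N) (w : List (Fin N)) : ℝ :=
  if ∀ p ∈ stepsOf w, EntryNonzero P X p.1 p.2 then
    potential K γ M (edgesOf (stepsOf w)) (w.headD i) else 0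

/-- The empty walk has potential one, and each step costs the one-step factor. The condition `n ≤ M`
keeps the number of visited vertices at most `M` before every step. -/
theorem sum_walkPotential_le (h : IsSparseWigner P X W C α) {K γ : ℝ} (hK : 0 ≤ K) (hγ : 0 < γ)
    {M : ℕ} (hM : 1 ≤ M) (hγW : γ ^ 2 = W + M ^ 3) (i : Fin N) {n : ℕ} (hn : n ≤ M) :
    ∑ w ∈ walks i n, walkPotential P X K γ M i w ≤ (2 * γ + M ^ 2 * K) ^ n := by
  classical
  induction n with
  | zero =>
    simp [walks, walkPotential, potential, excessWeight, excess, openDeg, numOpen]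
  | succ n ih =>
    rw [sum_walks_succ, pow_succ', ]
    refine le_trans ?_ (mul_le_mul_of_nonneg_left (ih (by omega)) (by positivity))
    rw [Finset.mul_sum]
    refine Finset.sum_le_sum fun w hw => ?_
    have e1 : ∀ u, walkPotential P X K γ M i (u :: w)
        = if EntryNonzero P X u (w.headD i) then
            (if ∀ p ∈ stepsOf w, EntryNonzero P X p.1 p.2 then
              potential K γ M (s(u, w.headD i) :: edgesOf (stepsOf w)) u else 0) else 0 := by
      intro u
      rw [walkPotential, stepsOf_cons_of_mem_walks hw]
      simp only [List.mem_cons, forall_eq_or_imp, edgesOf_cons, List.headD_cons, ite_and]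
    simp only [e1]
    rw [← Finset.sum_filter, walkPotential]
    split_ifs
    · refine sum_potential_cons_le hK hγ hM hγW _ _ w.toFinset _ ?_ ?_
        (h.card_filter_entryNonzero_le _)
      · exact (List.toFinset_card_le _).trans (by rw [length_of_mem_walks hw]; exact hn)
      · exact fun x y hxy => List.mem_toFinset.2 (mem_of_mem_edgesOf_stepsOf hxy).1
    · simp

/-- An open edge makes the expectation vanish by centring and independence. Without open edges the
factor `γ⁻¹` is absent, and `excessWeight` alone bounds the product of moments. -/
theorem norm_integral_entryProd_le [IsProbabilityMeasure P] (h : IsSparseWigner P X W C α)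
    {K γ : ℝ} (hK : 1 ≤ K) (hγ : 0 < γ) {M : ℕ} (hM : 1 ≤ M) {n : ℕ}
    (hmom : ∀ e k, 2 ≤ k → k ≤ n →
      ∫⁻ ω, ‖edgeVar X e ω‖ₑ ^ k ∂P ≤ ENNReal.ofReal (K ^ (k - 2)))
    (i : Fin N) {w : List (Fin N)} (hw : w ∈ walks i n) :
    ‖∫ ω, entryProd X (stepsOf w) ω ∂P‖ ≤ walkPotential P X K γ M i w := by
  have hK0 : 0 ≤ K := by linarith
  have hM' : (1 : ℝ) ≤ M := by exact_mod_cast hM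
  rw [walkPotential]
  split_ifs with hz
  · by_cases ho : ∃ e, (edgesOf (stepsOf w)).count e = 1
    · obtain ⟨e, he⟩ := ho
      rw [h.integral_centeredAt (h.centeredAt_entryProd he), norm_zero]
      exact potential_nonneg hK0 hγ.le _ _ _
    · push Not at ho
      have hno : numOpen (edgesOf (stepsOf w)) = 0 := by
        rw [numOpen, Finset.card_eq_zero, Finset.filter_eq_empty_iff]
        exact fun e _ => ho e
      rw [potential, hno, pow_zero, mul_one]
      refine le_trans ?_ (le_mul_of_one_le_right (excessWeight_nonneg hK0 _)
        (one_le_pow₀ hM'))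
      have hlen : (edgesOf (stepsOf w)).length ≤ n := by
        rw [edgesOf, List.length_map, stepsOf, List.length_zip, List.length_tail,
          length_of_mem_walks hw]
        omega
      rw [← ENNReal.ofReal_le_ofReal_iff (excessWeight_nonneg hK0 _), ofReal_norm]
      refine (enorm_integral_le_lintegral_enorm _).trans ?_
      rw [h.lintegral_entryProd, excessWeight,
        ENNReal.ofReal_prod_of_nonneg fun _ _ => by positivity]
      refine Finset.prod_le_prod' fun e _ => ?_
      rcases Nat.lt_or_ge ((edgesOf (stepsOf w)).count e) 2 with hc | hc
      · have hc0 : (edgesOf (stepsOf w)).count e = 0 := by have := ho e; omega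
        simp [hc0]
      · exact hmom e _ hc (List.count_le_length.trans hlen)
  · push Not at hz
    obtain ⟨p, hp, hp0⟩ := hz
    have := enorm_integral_le_lintegral_enorm (μ := P) (entryProd X (stepsOf w))
    rw [h.lintegral_entryProd_eq_zero hp hp0] at this
    simpa using this

theorem integrable_trace_pow [IsProbabilityMeasure P] (h : IsSparseWigner P X W C α) (n : ℕ) :
    Integrable (fun ω => (X ω ^ n).trace) P := by
  simp only [Matrix.trace, Matrix.diag, Matrix.pow_apply_eq_sum_walks]
  refine integrable_finsetSum _ fun i _ => integrable_finsetSum _ fun w _ => ?_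
  split_ifs
  · exact h.integrable_entryProd _
  · exact integrable_zero _ _ _

theorem integral_trace_pow_re_le [IsProbabilityMeasure P] (h : IsSparseWigner P X W C α)
    {K γ : ℝ} (hK : 1 ≤ K) (hγ : 0 < γ) {M : ℕ} (hM : 1 ≤ M) (hγW : γ ^ 2 = W + M ^ 3)
    {n : ℕ} (hn : n ≤ M)
    (hmom : ∀ e k, 2 ≤ k → k ≤ n →
      ∫⁻ ω, ‖edgeVar X e ω‖ₑ ^ k ∂P ≤ ENNReal.ofReal (K ^ (k - 2))) :
    ∫ ω, (X ω ^ n).trace.re ∂P ≤ N * (2 * γ + M ^ 2 * K) ^ n := by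
  have hK0 : 0 ≤ K := by linarith
  have h1 : ∫ ω, (X ω ^ n).trace.re ∂P = (∫ ω, (X ω ^ n).trace ∂P).re :=
    integral_re (h.integrable_trace_pow n)
  rw [h1]
  refine (Complex.re_le_norm _).trans ?_
  simp only [Matrix.trace, Matrix.diag, Matrix.pow_apply_eq_sum_walks]
  have hint : ∀ (i : Fin N) (w : List (Fin N)), Integrable (fun ω =>
      if w.headD i = i then ((stepsOf w).map fun p => X ω p.1 p.2).prod else 0) P := by
    intro i w
    split_ifs
    · exact h.integrable_entryProd _
    · exact integrable_zero _ _ _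
  rw [integral_finsetSum _ fun i _ => integrable_finsetSum _ fun w _ => hint i w]
  -- The requirement that the walk returns to `i` is dropped: the potential already penalizes open
  -- edges.
  calc _ ≤ ∑ i : Fin N, (2 * γ + M ^ 2 * K) ^ n := by
        refine (norm_sum_le _ _).trans (Finset.sum_le_sum fun i _ => ?_)
        rw [integral_finsetSum _ fun w _ => hint i w]
        refine (norm_sum_le _ _).trans (le_trans (Finset.sum_le_sum fun w hw => ?_)
          (h.sum_walkPotential_le hK0 hγ hM hγW i hn))
        have hb := h.norm_integral_entryProd_le hK hγ hM hmom i hw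
        split_ifs
        · exact hb
        · rw [integral_zero, norm_zero]; exact (norm_nonneg _).trans hb
    _ = _ := by simp

theorem measure_lambdaMax_ge_le [IsProbabilityMeasure P] (h : IsSparseWigner P X W C α)
    (hN : 0 < N) {K γ : ℝ} (hK : 1 ≤ K) (hγ : 0 < γ) {M : ℕ} (hM : 1 ≤ M)
    (hγW : γ ^ 2 = W + M ^ 3) {n : ℕ} (hn : n ≤ M) (hev : Even n)
    (hmom : ∀ e k, 2 ≤ k → k ≤ n →
      ∫⁻ ω, ‖edgeVar X e ω‖ₑ ^ k ∂P ≤ ENNReal.ofReal (K ^ (k - 2)))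
    {a : ℝ} (ha : 0 < a) :
    P {ω | a ≤ lambdaMax (h.herm ω)}
      ≤ ENNReal.ofReal (N * ((2 * γ + M ^ 2 * K) / a) ^ n) := by
  have hsub : {ω | a ≤ lambdaMax (h.herm ω)} ⊆ {ω | a ^ n ≤ (X ω ^ n).trace.re} := by
    intro ω hω
    exact (pow_le_pow_left₀ ha.le hω n).trans (lambdaMax_pow_le_trace hN (h.herm ω) hev)
  refine (measure_mono hsub).trans ?_
  have hi : Integrable (fun ω => (X ω ^ n).trace.re) P := (h.integrable_trace_pow n).re
  have hnn : 0 ≤ᵐ[P] fun ω => (X ω ^ n).trace.re := by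
    refine Eventually.of_forall fun ω => ?_
    exact (hev.pow_nonneg _).trans (lambdaMax_pow_le_trace hN (h.herm ω) hev)
  have hm := mul_meas_ge_le_integral_of_nonneg hnn hi (a ^ n)
  have hb := hm.trans (h.integral_trace_pow_re_le hK hγ hM hγW hn hmom)
  rw [← ofReal_measureReal]
  refine ENNReal.ofReal_le_ofReal ?_
  rw [div_pow, mul_div_assoc', le_div_iff₀ (by positivity), mul_comm]
  exact hb

end IsSparseWigner

/-! ### Second moments of sums of mostly uncorrelated terms. -/

section SecondMoment

variable {N : ℕ} {Ω : Type*} [MeasurableSpace Ω] {P : Measure Ω}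

theorem integrable_sq_norm_of_lintegral_le {Y : Ω → ℂ} (hY : Measurable Y) {b : ℝ}
    (hYb : ∫⁻ ω, ‖Y ω‖ₑ ^ 2 ∂P ≤ ENNReal.ofReal b) :
    MemLp Y 2 P ∧ (0 ≤ b → ∫ ω, ‖Y ω‖ ^ 2 ∂P ≤ b) := by
  have h1 : ∀ ω, ‖Y ω‖ₑ ^ 2 = ENNReal.ofReal (‖Y ω‖ ^ 2) := by
    intro ω
    rw [ENNReal.ofReal_pow (norm_nonneg _), ofReal_norm]
  have hi : Integrable (fun ω => ‖Y ω‖ ^ 2) P := by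
    refine ⟨(hY.norm.pow_const 2).aestronglyMeasurable, ?_⟩
    rw [hasFiniteIntegral_iff_enorm]
    refine lt_of_le_of_lt (le_of_eq (lintegral_congr fun ω => ?_))
      (hYb.trans_lt ENNReal.ofReal_lt_top)
    rw [enorm_pow, enorm_norm]
  refine ⟨(memLp_two_iff_integrable_sq_norm hY.aestronglyMeasurable).2 hi, fun hb => ?_⟩
  have := ofReal_integral_eq_lintegral_ofReal hi (Eventually.of_forall fun ω => by positivity)
  simp only [h1] at hYb
  rw [← this] at hYb
  exact (ENNReal.ofReal_le_ofReal_iff hb).1 hYb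

open Classical in
/-- The second moment of a vector valued sum whose terms are uncorrelated unless they are related,
each term being related to at most `R` others. -/
theorem lintegral_sum_enorm_sq_le {ι : Type*} (s : Finset ι) (Y : ι → Ω → ℂ) (t : ι → Fin N)
    (rel : ι → ι → Prop) (hsymm : ∀ w w', rel w w' → rel w' w) (R : ℕ)
    (hR : ∀ w ∈ s, (s.filter (rel w)).card ≤ R) (hY : ∀ w ∈ s, Measurable (Y w)) (b : ι → ℝ)
    (hb0 : ∀ w ∈ s, 0 ≤ b w) (hb : ∀ w ∈ s, ∫⁻ ω, ‖Y w ω‖ₑ ^ 2 ∂P ≤ ENNReal.ofReal (b w))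
    (h0 : ∀ w ∈ s, ∀ w' ∈ s, ¬ rel w w' → ∫ ω, Y w ω * star (Y w' ω) ∂P = 0) :
    ∫⁻ ω, ∑ j, ‖∑ w ∈ s, if t w = j then Y w ω else 0‖ₑ ^ 2 ∂P
      ≤ ENNReal.ofReal (R * ∑ w ∈ s, b w) := by
  have hL : ∀ w ∈ s, MemLp (Y w) 2 P := fun w hw =>
    (integrable_sq_norm_of_lintegral_le (hY w hw) (hb w hw)).1
  have hI : ∀ w ∈ s, ∀ w' ∈ s, Integrable (fun ω => Y w ω * star (Y w' ω)) P :=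
    fun w hw w' hw' => (hL w hw).integrable_mul (hL w' hw').star
  have hpt : ∀ ω, ∑ j, ‖∑ w ∈ s, if t w = j then Y w ω else 0‖ ^ 2
      = ∑ w ∈ s, ∑ w' ∈ s, if t w = t w' then (Y w ω * star (Y w' ω)).re else 0 := by
    intro ω
    have hj : ∀ j, ‖∑ w ∈ s, if t w = j then Y w ω else 0‖ ^ 2
        = ∑ w ∈ s, ∑ w' ∈ s, if t w = j then
            (if t w = t w' then (Y w ω * star (Y w' ω)).re else 0) else 0 := by
      intro j
      have hz : ∀ z : ℂ, ‖z‖ ^ 2 = (z * star z).re := by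
        intro z
        rw [RCLike.star_def, Complex.mul_conj, Complex.ofReal_re, Complex.normSq_eq_norm_sq]
      rw [hz, star_sum, Finset.sum_mul_sum, Complex.re_sum]
      refine Finset.sum_congr rfl fun w _ => ?_
      rw [Complex.re_sum]
      refine Finset.sum_congr rfl fun w' _ => ?_
      by_cases h1 : t w = j
      · by_cases h2 : t w' = j
        · simp [h1, h2]
        · simp [h1, h2, Ne.symm h2]
      · simp [h1]
    simp only [hj]
    rw [Finset.sum_comm]
    refine Finset.sum_congr rfl fun w _ => ?_
    rw [Finset.sum_comm]
    refine Finset.sum_congr rfl fun w' _ => ?_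
    simp
  have hIre : ∀ w ∈ s, ∀ w' ∈ s, Integrable
      (fun ω => if t w = t w' then (Y w ω * star (Y w' ω)).re else 0) P := by
    intro w hw w' hw'
    split_ifs
    · exact (hI w hw w' hw').re
    · exact integrable_zero _ _ _
  have hbound : ∀ w ∈ s, ∀ w' ∈ s,
      ∫ ω, (if t w = t w' then (Y w ω * star (Y w' ω)).re else 0) ∂P
        ≤ if rel w w' then (b w + b w') / 2 else 0 := by
    intro w hw w' hw'
    have b1 := (integrable_sq_norm_of_lintegral_le (hY w hw) (hb w hw)).2 (hb0 w hw)
    have b2 := (integrable_sq_norm_of_lintegral_le (hY w' hw') (hb w' hw')).2 (hb0 w' hw')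
    have b0 := hb0 w hw
    have b0' := hb0 w' hw'
    by_cases ht : t w = t w'
    · simp only [ht, if_true]
      have hre : ∫ ω, (Y w ω * star (Y w' ω)).re ∂P = (∫ ω, Y w ω * star (Y w' ω) ∂P).re :=
        integral_re (hI w hw w' hw')
      split_ifs with hr
      · have i1 := (memLp_two_iff_integrable_sq_norm (hY w hw).aestronglyMeasurable).1 (hL w hw)
        have i2 := (memLp_two_iff_integrable_sq_norm (hY w' hw').aestronglyMeasurable).1 (hL w' hw')
        calc _ ≤ ∫ ω, (‖Y w ω‖ ^ 2 + ‖Y w' ω‖ ^ 2) / 2 ∂P := by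
              refine integral_mono (hI w hw w' hw').re ((i1.add i2).div_const 2) fun ω => ?_
              refine (Complex.re_le_norm _).trans ?_
              rw [norm_mul, norm_star]
              nlinarith [sq_nonneg (‖Y w ω‖ - ‖Y w' ω‖)]
          _ ≤ _ := by
              rw [integral_div, integral_add i1 i2]
              gcongr
      · rw [hre, h0 w hw w' hw' hr, Complex.zero_re]
    · simp only [ht, if_false, integral_zero]
      split_ifs <;> positivity
  have hE : ∀ ω, ∑ j, ‖∑ w ∈ s, if t w = j then Y w ω else 0‖ₑ ^ 2
      = ENNReal.ofReal (∑ j, ‖∑ w ∈ s, if t w = j then Y w ω else 0‖ ^ 2) := by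
    intro ω
    rw [ENNReal.ofReal_sum_of_nonneg fun _ _ => by positivity]
    refine Finset.sum_congr rfl fun j _ => ?_
    rw [ENNReal.ofReal_pow (norm_nonneg _), ofReal_norm]
  simp only [hE]
  rw [← ofReal_integral_eq_lintegral_ofReal]
  · refine ENNReal.ofReal_le_ofReal ?_
    simp only [hpt]
    rw [integral_finsetSum _ fun w hw => integrable_finsetSum _ (hIre w hw)]
    calc _ ≤ ∑ w ∈ s, ∑ w' ∈ s, if rel w w' then (b w + b w') / 2 else 0 := by
          refine Finset.sum_le_sum fun w hw => ?_
          rw [integral_finsetSum _ (hIre w hw)]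
          exact Finset.sum_le_sum (hbound w hw)
      -- By symmetry of `rel`, the two halves of the average have the same double sum.
      _ = ∑ w ∈ s, ∑ w' ∈ s, if rel w w' then b w else 0 := by
          have e1 : ∀ w w', (if rel w w' then (b w + b w') / 2 else 0)
              = (if rel w w' then b w else 0) / 2 + (if rel w' w then b w' else 0) / 2 := by
            intro w w'
            by_cases hr : rel w w'
            · simp [hr, hsymm _ _ hr]; ring
            · have hr' : ¬ rel w' w := fun h => hr (hsymm _ _ h)
              simp [hr, hr']
          simp only [e1, Finset.sum_add_distrib]
          rw [Finset.sum_comm (f := fun w w' => (if rel w' w then b w' else 0) / 2)]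
          simp only [← Finset.sum_div]
          ring
      _ ≤ ∑ w ∈ s, R * b w := by
          refine Finset.sum_le_sum fun w hw => ?_
          rw [← Finset.sum_filter, Finset.sum_const, nsmul_eq_mul]
          exact mul_le_mul_of_nonneg_right (by exact_mod_cast hR w hw) (hb0 w hw)
      _ = _ := by rw [Finset.mul_sum]
  · simp only [hpt]
    exact integrable_finsetSum _ fun w hw => integrable_finsetSum _ (hIre w hw)
  · exact Eventually.of_forall fun ω => Finset.sum_nonneg fun _ _ => by positivity

end SecondMoment

/-! ### Combinatorics of self-avoiding walks. -/

section SelfAvoiding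

variable {N : ℕ}

/-- The self-avoiding walks of length `n` from `i`. -/
def saws (i : Fin N) (n : ℕ) : Finset (List (Fin N)) := (walks i n).filter List.Nodup

theorem sum_saws_succ {β : Type*} [AddCommMonoid β] (i : Fin N) (n : ℕ) (f : List (Fin N) → β) :
    ∑ h ∈ saws i (n + 1), f h = ∑ h ∈ saws i n, ∑ u, if u ∈ h then 0 else f (u :: h) := by
  rw [saws, saws, Finset.sum_filter, Finset.sum_filter, sum_walks_succ]
  refine Finset.sum_congr rfl fun h _ => ?_
  by_cases hn : h.Nodup
  · rw [if_pos hn]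
    refine Finset.sum_congr rfl fun u _ => ?_
    by_cases hu : u ∈ h <;> simp [hn, hu]
  · simp [hn]

theorem nodup_edgesOf_stepsOf : ∀ {h : List (Fin N)}, h.Nodup → (edgesOf (stepsOf h)).Nodup
  | [], _ => by simp [stepsOf]
  | [_], _ => by simp
  | u :: v :: t, hn => by
    rw [List.nodup_cons] at hn
    rw [stepsOf_cons_cons, edgesOf_cons, List.nodup_cons]
    exact ⟨fun hc => hn.1 (mem_of_mem_edgesOf_stepsOf hc).1, nodup_edgesOf_stepsOf hn.2⟩

theorem exists_mem_edgesOf_stepsOf {x : Fin N} :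
    ∀ {h : List (Fin N)}, 2 ≤ h.length → x ∈ h → ∃ y, s(x, y) ∈ edgesOf (stepsOf h)
  | [], h2, _ => by simp at h2
  | [_], h2, _ => by simp at h2
  | u :: v :: t, _, hx => by
    rw [stepsOf_cons_cons, edgesOf_cons]
    rcases List.mem_cons.1 hx with rfl | hx
    · exact ⟨v, by simp⟩
    rcases List.mem_cons.1 hx with rfl | hx'
    · exact ⟨u, by simp [Sym2.eq_swap]⟩
    · have : 2 ≤ (v :: t).length := by
        have := List.length_pos_of_mem hx'
        simp only [List.length_cons]; omega
      obtain ⟨y, hy⟩ := exists_mem_edgesOf_stepsOf this hx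
      exact ⟨y, List.mem_cons_of_mem _ hy⟩

/-- Both vertex sets have `n + 1` elements, so neither can strictly contain the other. An edge of
`w` at the vertex found is then absent from `w'`, which makes the products uncorrelated. -/
theorem exists_mem_notMem_of_saws {i : Fin N} {n : ℕ} {w w' : List (Fin N)} (hw : w ∈ saws i n)
    (hw' : w' ∈ saws i n) (h : w.toFinset ≠ w'.toFinset) : ∃ x ∈ w, x ∉ w' := by
  rw [saws, Finset.mem_filter] at hw hw'
  by_contra hc
  push Not at hc
  refine h (Finset.eq_of_subset_of_card_le (fun x hx => ?_) ?_)
  · exact List.mem_toFinset.2 (hc x (List.mem_toFinset.1 hx))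
  · rw [List.toFinset_card_of_nodup hw.2, List.toFinset_card_of_nodup hw'.2,
      length_of_mem_walks hw.1, length_of_mem_walks hw'.1]

theorem pos_of_saws_mem_notMem {i : Fin N} {n : ℕ} {w w' : List (Fin N)} (hw : w ∈ saws i n)
    (hw' : w' ∈ saws i n) {x : Fin N} (hx : x ∈ w) (hx' : x ∉ w') : 2 ≤ w.length := by
  rw [saws, Finset.mem_filter] at hw hw'
  rw [length_of_mem_walks hw.1]
  rcases Nat.eq_zero_or_pos n with rfl | hn
  · simp only [walks, Finset.mem_singleton] at hw hw'
    rw [hw.1] at hx; rw [hw'.1] at hx'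
    exact absurd hx hx'
  · omega

/-- Repetition-free lists with the same vertex set are permutations of one another. The factorial is
harmless because lengths stay bounded in the lower tail. -/
theorem card_saws_filter_toFinset_le (i : Fin N) (n : ℕ) {w : List (Fin N)} (hw : w ∈ saws i n) :
    ((saws i n).filter fun w' => w.toFinset = w'.toFinset).card ≤ (n + 1).factorial := by
  classical
  have hw2 := Finset.mem_filter.1 hw
  calc _ ≤ w.permutations.toFinset.card := by
        refine Finset.card_le_card fun w' hw' => ?_
        rw [Finset.mem_filter] at hw'
        have hw3 := Finset.mem_filter.1 hw'.1
        rw [List.mem_toFinset, List.mem_permutations]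
        exact (List.perm_of_nodup_nodup_toFinset_eq hw2.2 hw3.2 hw'.2).symm
    _ ≤ w.permutations.length := List.toFinset_card_le _
    _ = _ := by rw [List.length_permutations, length_of_mem_walks hw2.1]

end SelfAvoiding

/-! ### The vectors of self-avoiding walk sums and their recursion. -/

open Classical in
/-- The indicator of the nonzero entries. -/
noncomputable def entryInd {N : ℕ} {Ω : Type*} [MeasurableSpace Ω] (P : Measure Ω)
    (X : Ω → Matrix (Fin N) (Fin N) ℂ) (u v : Fin N) : ℝ :=
  if EntryNonzero P X u v then 1 else 0

open Classical in
/-- The indicator of the lists of nonzero entries. -/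
noncomputable def listInd {N : ℕ} {Ω : Type*} [MeasurableSpace Ω] (P : Measure Ω)
    (X : Ω → Matrix (Fin N) (Fin N) ℂ) (L : List (Fin N × Fin N)) : ℝ :=
  if ∀ p ∈ L, EntryNonzero P X p.1 p.2 then 1 else 0

/-- The sum of the products of entries along the self-avoiding walks of length `n` from `i`, sorted by
endpoint. -/
noncomputable def sawVec {N : ℕ} {Ω : Type*} (X : Ω → Matrix (Fin N) (Fin N) ℂ) (i : Fin N) (n : ℕ)
    (ω : Ω) (j : Fin N) : ℂ :=
  ∑ w ∈ saws i n, if w.headD i = j then entryProd X (stepsOf w) ω else 0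

/-- The self-avoiding walks of length `n` from `i` with a vertex of the walk to which the next step
leads without traversing the last edge. -/
def loopPairs {N : ℕ} (i : Fin N) (n : ℕ) : Finset (List (Fin N) × Fin N) :=
  (saws i n ×ˢ Finset.univ).filter fun q => q.2 ∈ q.1 ∧ q.1.tail.head? ≠ some q.2

/-- The contribution of the walks whose last step closes a cycle or a loop. -/
noncomputable def loopVec {N : ℕ} {Ω : Type*} (X : Ω → Matrix (Fin N) (Fin N) ℂ) (i : Fin N) (n : ℕ)
    (ω : Ω) (j : Fin N) : ℂ :=
  ∑ q ∈ loopPairs i n, if q.2 = j then entryProd X ((q.2, q.1.headD i) :: stepsOf q.1) ω else 0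

/-- The contribution of the fluctuations of the squares of the entries at backtracking steps. -/
noncomputable def fluctVec {N : ℕ} {Ω : Type*} [MeasurableSpace Ω] (P : Measure Ω)
    (X : Ω → Matrix (Fin N) (Fin N) ℂ) (i : Fin N) (n : ℕ) (ω : Ω) (j : Fin N) : ℂ :=
  ∑ w ∈ saws i (n + 1), if w.tail.headD i = j then
    ((‖X ω (w.headD i) (w.tail.headD i)‖ ^ 2 - entryInd P X (w.headD i) (w.tail.headD i) : ℝ) : ℂ)
      * entryProd X (stepsOf w.tail) ω else 0

/-- The difference between the number of nonzero continuations of a self-avoiding walk and `W`. -/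
noncomputable def degreeDefect {N : ℕ} {Ω : Type*} [MeasurableSpace Ω] (P : Measure Ω)
    (X : Ω → Matrix (Fin N) (Fin N) ℂ) (W : ℕ) (i : Fin N) (w : List (Fin N)) : ℝ :=
  (∑ u, if u ∈ w then 0 else entryInd P X u (w.headD i)) - W

/-- The contribution of the degree defects. -/
noncomputable def defectVec {N : ℕ} {Ω : Type*} [MeasurableSpace Ω] (P : Measure Ω)
    (X : Ω → Matrix (Fin N) (Fin N) ℂ) (W : ℕ) (i : Fin N) (n : ℕ) (ω : Ω) (j : Fin N) : ℂ :=
  ∑ w ∈ saws i n, if w.headD i = j then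
    entryProd X (stepsOf w) ω * (degreeDefect P X W i w : ℂ) else 0

section Recursion

variable {N : ℕ}

theorem mem_walks_of_mem_saws {i : Fin N} {n : ℕ} {w : List (Fin N)} (hw : w ∈ saws i n) :
    w ∈ walks i n := (Finset.mem_filter.1 hw).1

theorem nodup_of_mem_saws {i : Fin N} {n : ℕ} {w : List (Fin N)} (hw : w ∈ saws i n) :
    w.Nodup := (Finset.mem_filter.1 hw).2

/-- The next vertex `j` is either new, or visited but not the previous one, or the previous one; the
three terms correspond to these cases. -/
theorem mulVec_sawVec_aux {Ω : Type*} (X : Ω → Matrix (Fin N) (Fin N) ℂ) (i : Fin N) (n : ℕ)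
    (ω : Ω) (j : Fin N) : (X ω).mulVec (sawVec X i n ω) j = sawVec X i (n + 1) ω j
      + loopVec X i n ω j + ∑ w ∈ saws i n, if w.tail.head? = some j then
        X ω j (w.headD i) * entryProd X (stepsOf w) ω else 0 := by
  have e1 : (X ω).mulVec (sawVec X i n ω) j
      = ∑ w ∈ saws i n, X ω j (w.headD i) * entryProd X (stepsOf w) ω := by
    simp only [Matrix.mulVec, dotProduct, sawVec, Finset.mul_sum]
    rw [Finset.sum_comm]
    refine Finset.sum_congr rfl fun w _ => ?_
    simp
  have e2 : sawVec X i (n + 1) ω j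
      = ∑ w ∈ saws i n, if j ∈ w then 0 else X ω j (w.headD i) * entryProd X (stepsOf w) ω := by
    rw [sawVec, sum_saws_succ]
    refine Finset.sum_congr rfl fun w hw => ?_
    rw [Finset.sum_eq_single j]
    · rw [stepsOf_cons_of_mem_walks (mem_walks_of_mem_saws hw)]
      simp
    · intro b _ hb; simp [hb]
    · simp
  have e3 : loopVec X i n ω j = ∑ w ∈ saws i n, if j ∈ w ∧ w.tail.head? ≠ some j then
      X ω j (w.headD i) * entryProd X (stepsOf w) ω else 0 := by
    rw [loopVec, loopPairs, Finset.sum_filter, Finset.sum_product]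
    refine Finset.sum_congr rfl fun w _ => ?_
    rw [Finset.sum_eq_single j]
    · simp
    · intro b _ hb; simp [hb]
    · simp
  rw [e1, e2, e3, ← Finset.sum_add_distrib, ← Finset.sum_add_distrib]
  refine Finset.sum_congr rfl fun w _ => ?_
  by_cases h1 : w.tail.head? = some j
  · have : j ∈ w := List.mem_of_mem_tail (List.mem_of_mem_head? h1)
    simp [h1, this]
  · rw [if_neg h1]
    by_cases h2 : j ∈ w
    · rw [if_pos h2, if_pos ⟨h2, h1⟩]; ring
    · rw [if_neg h2, if_neg fun h => h2 h.1]; ring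

theorem mulVec_sawVec_zero {Ω : Type*} (X : Ω → Matrix (Fin N) (Fin N) ℂ) (i : Fin N) (ω : Ω) :
    (X ω).mulVec (sawVec X i 0 ω) = sawVec X i 1 ω + loopVec X i 0 ω := by
  funext j
  rw [mulVec_sawVec_aux]
  simp [saws, walks, Finset.filter_singleton]

theorem mulVec_sawVec_succ {Ω : Type*} [MeasurableSpace Ω] (P : Measure Ω)
    (X : Ω → Matrix (Fin N) (Fin N) ℂ) (hX : ∀ ω, (X ω).IsHermitian) (W : ℕ) (i : Fin N) (n : ℕ)
    (ω : Ω) : (X ω).mulVec (sawVec X i (n + 1) ω) = sawVec X i (n + 2) ω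
      + (W : ℂ) • sawVec X i n ω
      + (loopVec X i (n + 1) ω + fluctVec P X i n ω + defectVec P X W i n ω) := by
  funext j
  rw [mulVec_sawVec_aux]
  -- A backtracking step multiplies the shorter walk by `|X| ^ 2`. Subtracting the indicator leaves
  -- the fluctuation; the sum of indicators over the removed vertex is `W` plus the degree defect.
  have e1 : (∑ w ∈ saws i (n + 1), if w.tail.head? = some j then
        X ω j (w.headD i) * entryProd X (stepsOf w) ω else 0)
      = (W : ℂ) * sawVec X i n ω j + fluctVec P X i n ω j + defectVec P X W i n ω j := by
    rw [fluctVec, sawVec, defectVec, Finset.mul_sum, sum_saws_succ, sum_saws_succ,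
      ← Finset.sum_add_distrib, ← Finset.sum_add_distrib]
    refine Finset.sum_congr rfl fun w hw => ?_
    obtain ⟨v, t, rfl⟩ := exists_cons_of_mem_walks (mem_walks_of_mem_saws hw)
    simp only [List.tail_cons, List.head?_cons, List.headD_cons, stepsOf_cons_cons,
      entryProd_cons, Option.some.injEq]
    by_cases hj : v = j
    · subst hj
      simp only [if_true, degreeDefect, List.headD_cons]
      have e2 : ∀ u, X ω v u * (X ω u v * entryProd X (stepsOf (v :: t)) ω)
          = ((‖X ω u v‖ ^ 2 - entryInd P X u v : ℝ) : ℂ) * entryProd X (stepsOf (v :: t)) ω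
            + entryProd X (stepsOf (v :: t)) ω * (entryInd P X u v : ℂ) := by
        intro u
        have : X ω v u * X ω u v = ((‖X ω u v‖ ^ 2 : ℝ) : ℂ) := by
          rw [← (hX ω).apply v u, RCLike.star_def, mul_comm, Complex.mul_conj,
            Complex.normSq_eq_norm_sq]
        rw [← mul_assoc, this, Complex.ofReal_sub]
        ring
      have e3 : ∀ u, (if u ∈ v :: t then 0 else
            X ω v u * (X ω u v * entryProd X (stepsOf (v :: t)) ω))
          = (if u ∈ v :: t then 0 else ((‖X ω u v‖ ^ 2 - entryInd P X u v : ℝ) : ℂ)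
              * entryProd X (stepsOf (v :: t)) ω)
            + entryProd X (stepsOf (v :: t)) ω
              * ((if u ∈ v :: t then 0 else entryInd P X u v : ℝ) : ℂ) := by
        intro u
        split_ifs
        · simp
        · exact e2 u
      simp only [e3, Finset.sum_add_distrib, ← Finset.mul_sum]
      push_cast
      ring
    · simp [hj]
  rw [e1]
  simp only [Pi.add_apply, Pi.smul_apply, smul_eq_mul]
  ring

end Recursion

/-! ### Second moments of the walk vector and of the three error vectors. -/

namespace IsSparseWigner

variable {N : ℕ} {Ω : Type*} [MeasurableSpace Ω] {P : Measure Ω}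
  {X : Ω → Matrix (Fin N) (Fin N) ℂ} {W : ℕ} {C α : ℝ}

theorem _root_.listInd_nonneg (L : List (Fin N × Fin N)) : 0 ≤ listInd P X L := by
  unfold listInd; split_ifs <;> norm_num

theorem lintegral_edgeVar_pow_count_le [IsProbabilityMeasure P] (h : IsSparseWigner P X W C α)
    {E : List (Sym2 (Fin N))} (hE : E.Nodup) (e : Sym2 (Fin N)) :
    ∫⁻ ω, ‖edgeVar X e ω‖ₑ ^ (E.count e + E.count e) ∂P ≤ 1 := by
  have := List.nodup_iff_count_le_one.1 hE e
  rcases Nat.lt_or_ge (E.count e) 1 with hc | hc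
  · rw [show E.count e = 0 by omega]; simp
  · rw [show E.count e = 1 by omega]; exact h.lintegral_edgeVar_sq_le e

theorem lintegral_entryProd_sq_le [IsProbabilityMeasure P] (h : IsSparseWigner P X W C α)
    {L : List (Fin N × Fin N)} (hL : (edgesOf L).Nodup) :
    ∫⁻ ω, ‖entryProd X L ω‖ₑ ^ 2 ∂P ≤ ENNReal.ofReal (listInd P X L) := by
  simp only [enorm_sq_entryProd]
  rw [listInd]
  split_ifs with hz
  · rw [h.lintegral_entryProd, ENNReal.ofReal_one]
    refine Finset.prod_le_one' fun e _ => ?_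
    rw [edgesOf_append, List.count_append]
    exact h.lintegral_edgeVar_pow_count_le hL e
  · push Not at hz
    obtain ⟨p, hp, hp0⟩ := hz
    rw [h.lintegral_entryProd_eq_zero (List.mem_append_left _ hp) hp0]
    exact zero_le

theorem lintegral_fluct_sq_le [IsProbabilityMeasure P] (h : IsSparseWigner P X W C α)
    {L : List (Fin N × Fin N)} {p : Fin N × Fin N} (hL : (edgesOf (p :: L)).Nodup) {B : ℝ}
    (hB0 : 0 ≤ B) (hB : ∀ e, ∫⁻ ω, ‖edgeVar X e ω‖ₑ ^ 4 ∂P ≤ ENNReal.ofReal B) :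
    ∫⁻ ω, ‖((‖X ω p.1 p.2‖ ^ 2 - entryInd P X p.1 p.2 : ℝ) : ℂ) * entryProd X L ω‖ₑ ^ 2 ∂P
      ≤ ENNReal.ofReal ((B + 1) * listInd P X (p :: L)) := by
  have hpt : ∀ ω, ‖((‖X ω p.1 p.2‖ ^ 2 - entryInd P X p.1 p.2 : ℝ) : ℂ) * entryProd X L ω‖ₑ ^ 2
      ≤ ‖entryProd X (p :: p :: p :: p :: (L ++ L)) ω‖ₑ
        + ENNReal.ofReal (entryInd P X p.1 p.2) * ‖entryProd X (L ++ L) ω‖ₑ := by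
    intro ω
    -- For nonnegative numbers `(a - b) ^ 2 ≤ a ^ 2 + b ^ 2`; this is the source of the constant `B
    -- + 1`.
    have e1 : ‖((‖X ω p.1 p.2‖ ^ 2 - entryInd P X p.1 p.2 : ℝ) : ℂ)‖ₑ ^ 2
        ≤ ‖X ω p.1 p.2‖ₑ ^ 4 + ENNReal.ofReal (entryInd P X p.1 p.2) := by
      rw [← ofReal_norm, ← ofReal_norm, ← ENNReal.ofReal_pow (norm_nonneg _),
        ← ENNReal.ofReal_pow (norm_nonneg _), Complex.norm_real, Real.norm_eq_abs, sq_abs]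
      have : 0 ≤ ‖X ω p.1 p.2‖ := norm_nonneg _
      unfold entryInd
      split_ifs
      · rw [← ENNReal.ofReal_add (by positivity) (by norm_num)]
        refine ENNReal.ofReal_le_ofReal ?_
        nlinarith [sq_nonneg ‖X ω p.1 p.2‖]
      · rw [ENNReal.ofReal_zero, add_zero]
        refine ENNReal.ofReal_le_ofReal ?_
        nlinarith
    rw [enorm_mul, mul_pow, enorm_sq_entryProd]
    refine (mul_le_mul_left e1 _).trans (le_of_eq ?_)
    simp only [entryProd_cons, enorm_mul]
    ring
  refine (lintegral_mono hpt).trans ?_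
  rw [lintegral_add_left (h.measurable_entryProd _).enorm,
    lintegral_const_mul _ (h.measurable_entryProd _).enorm]
  have hL' : (edgesOf L).Nodup := by
    rw [edgesOf_cons, List.nodup_cons] at hL; exact hL.2
  have hpL : s(p.1, p.2) ∉ edgesOf L := by
    rw [edgesOf_cons, List.nodup_cons] at hL; exact hL.1
  by_cases hz : ∀ q ∈ p :: L, EntryNonzero P X q.1 q.2
  · rw [listInd, if_pos hz, mul_one, ENNReal.ofReal_add hB0 zero_le_one]
    refine add_le_add ?_ ?_
    · rw [h.lintegral_entryProd]
      calc _ ≤ ∏ e, (if e = s(p.1, p.2) then ENNReal.ofReal B else 1) := by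
            refine Finset.prod_le_prod' fun e _ => ?_
            simp only [edgesOf_cons, edgesOf_append, List.count_cons, List.count_append]
            split_ifs with he1 he2 he2
            · rw [he2, List.count_eq_zero_of_not_mem hpL]
              exact hB _
            · exact absurd (beq_iff_eq.1 he1).symm he2
            · exact absurd (beq_iff_eq.2 he2.symm) he1
            · exact h.lintegral_edgeVar_pow_count_le hL' e
        _ = _ := by simp
    · rw [entryInd, if_pos (hz p List.mem_cons_self), ENNReal.ofReal_one, one_mul]
      simp only [← enorm_sq_entryProd]
      refine (h.lintegral_entryProd_sq_le hL').trans ?_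
      rw [listInd]
      split_ifs <;> simp
  · rw [listInd, if_neg hz, mul_zero, ENNReal.ofReal_zero]
    by_cases hp : EntryNonzero P X p.1 p.2
    · push Not at hz
      obtain ⟨q, hq, hq0⟩ := hz
      have hqL : q ∈ L := by
        rcases List.mem_cons.1 hq with rfl | hq'
        · exact absurd hp hq0
        · exact hq'
      rw [h.lintegral_entryProd_eq_zero (p := q) (by simp [hqL]) hq0,
        h.lintegral_entryProd_eq_zero (List.mem_append_left _ hqL) hq0]
      simp
    · rw [h.lintegral_entryProd_eq_zero List.mem_cons_self hp, entryInd, if_neg hp]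
      simp

theorem integral_mul_star_eq_zero (h : IsSparseWigner P X W C α) {e : Sym2 (Fin N)} {Y Y' : Ω → ℂ}
    (hY : CenteredAt P X e Y) (hY' : Measurable[sigmaOff X e] Y') :
    ∫ ω, Y ω * star (Y' ω) ∂P = 0 :=
  h.integral_centeredAt (hY.mul (continuous_star.measurable.comp hY'))

theorem _root_.notMem_edgesOf_stepsOf {w : List (Fin N)} {x : Fin N} (hx : x ∉ w) (y : Fin N) :
    s(x, y) ∉ edgesOf (stepsOf w) := fun hc => hx (mem_of_mem_edgesOf_stepsOf hc).1

/-- If the vertex sets differ, some edge occurs exactly once in `w` and not at all in `w'`, so the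
correlation is zero. The three bounds for the error vectors use the same argument. -/
theorem lintegral_sawVec_le [IsProbabilityMeasure P] (h : IsSparseWigner P X W C α) (i : Fin N)
    (n : ℕ) : ∫⁻ ω, ∑ j, ‖sawVec X i n ω j‖ₑ ^ 2 ∂P
      ≤ ENNReal.ofReal ((n + 1).factorial * ∑ w ∈ saws i n, listInd P X (stepsOf w)) := by
  refine lintegral_sum_enorm_sq_le (saws i n) (fun w => entryProd X (stepsOf w)) (fun w => w.headD i)
    (fun w w' => w.toFinset = w'.toFinset) (fun _ _ => Eq.symm) _ ?_
    (fun w _ => h.measurable_entryProd _) _ (fun w _ => listInd_nonneg _)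
    (fun w hw => h.lintegral_entryProd_sq_le (nodup_edgesOf_stepsOf (nodup_of_mem_saws hw))) ?_
  · intro w hw
    convert card_saws_filter_toFinset_le i n hw
  · intro w hw w' hw' hne
    obtain ⟨x, hx, hx'⟩ := exists_mem_notMem_of_saws hw hw' hne
    obtain ⟨y, hy⟩ := exists_mem_edgesOf_stepsOf (pos_of_saws_mem_notMem hw hw' hx hx') hx
    refine h.integral_mul_star_eq_zero (h.centeredAt_entryProd (e := s(x, y)) ?_)
      (h.measurable_entryProd_sigmaOff (notMem_edgesOf_stepsOf hx' y))
    exact List.count_eq_one_of_mem (nodup_edgesOf_stepsOf (nodup_of_mem_saws hw)) hy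

theorem lintegral_defectVec_le [IsProbabilityMeasure P] (h : IsSparseWigner P X W C α) (i : Fin N)
    (n : ℕ) : ∫⁻ ω, ∑ j, ‖defectVec P X W i n ω j‖ₑ ^ 2 ∂P
      ≤ ENNReal.ofReal ((n + 1).factorial * ∑ w ∈ saws i n,
          listInd P X (stepsOf w) * degreeDefect P X W i w ^ 2) := by
  refine lintegral_sum_enorm_sq_le (saws i n)
    (fun w ω => entryProd X (stepsOf w) ω * (degreeDefect P X W i w : ℂ)) (fun w => w.headD i)
    (fun w w' => w.toFinset = w'.toFinset) (fun _ _ => Eq.symm) _ ?_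
    (fun w _ => (h.measurable_entryProd _).mul_const _) _
    (fun w _ => mul_nonneg (listInd_nonneg _) (sq_nonneg _)) (fun w hw => ?_) ?_
  · intro w hw
    convert card_saws_filter_toFinset_le i n hw
  · have e1 : ‖(degreeDefect P X W i w : ℂ)‖ₑ ^ 2 = ENNReal.ofReal (degreeDefect P X W i w ^ 2) := by
      rw [← ofReal_norm, ← ENNReal.ofReal_pow (norm_nonneg _), Complex.norm_real,
        Real.norm_eq_abs, sq_abs]
    simp only [enorm_mul, mul_pow, e1]
    rw [lintegral_mul_const _ ((h.measurable_entryProd _).enorm.pow_const 2),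
      ENNReal.ofReal_mul (listInd_nonneg _)]
    exact mul_le_mul_left
      (h.lintegral_entryProd_sq_le (nodup_edgesOf_stepsOf (nodup_of_mem_saws hw))) _
  · intro w hw w' hw' hne
    obtain ⟨x, hx, hx'⟩ := exists_mem_notMem_of_saws hw hw' hne
    obtain ⟨y, hy⟩ := exists_mem_edgesOf_stepsOf (pos_of_saws_mem_notMem hw hw' hx hx') hx
    refine h.integral_mul_star_eq_zero
      ((h.centeredAt_entryProd (e := s(x, y)) ?_).mul measurable_const)
      (Measurable.mul_const
        (h.measurable_entryProd_sigmaOff (notMem_edgesOf_stepsOf hx' y)) _)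
    exact List.count_eq_one_of_mem (nodup_edgesOf_stepsOf (nodup_of_mem_saws hw)) hy

/-- The only edge of a self-avoiding walk at its endpoint leads to the previous vertex, and this one
is excluded for `a`. -/
theorem _root_.nodup_edgesOf_loop {i : Fin N} {w : List (Fin N)} {a : Fin N} (hw : w.Nodup)
    (ha : w.tail.head? ≠ some a) : (edgesOf ((a, w.headD i) :: stepsOf w)).Nodup := by
  rw [edgesOf_cons, List.nodup_cons]
  refine ⟨fun hc => ?_, nodup_edgesOf_stepsOf hw⟩
  match w, hw, ha, hc with
  | [], _, _, hc => simp [stepsOf] at hc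
  | [_], _, _, hc => simp at hc
  | u :: v :: t, hw, ha, hc =>
    rw [List.nodup_cons] at hw
    simp only [List.headD_cons, stepsOf_cons_cons, edgesOf_cons, List.mem_cons] at hc
    rcases hc with hc | hc
    · rw [Sym2.eq_swap] at hc
      exact ha (by simp [Sym2.congr_right.1 hc])
    · exact hw.1 (mem_of_mem_edgesOf_stepsOf hc).2

theorem _root_.mem_loopPairs {i : Fin N} {n : ℕ} {q : List (Fin N) × Fin N} :
    q ∈ loopPairs i n ↔ q.1 ∈ saws i n ∧ q.2 ∈ q.1 ∧ q.1.tail.head? ≠ some q.2 := by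
  simp [loopPairs]

theorem lintegral_loopVec_le [IsProbabilityMeasure P] (h : IsSparseWigner P X W C α) (i : Fin N)
    (n : ℕ) : ∫⁻ ω, ∑ j, ‖loopVec X i n ω j‖ₑ ^ 2 ∂P
      ≤ ENNReal.ofReal (((n + 1).factorial * (n + 1) : ℕ) *
          ∑ q ∈ loopPairs i n, listInd P X (stepsOf q.1)) := by
  refine lintegral_sum_enorm_sq_le (loopPairs i n)
    (fun q => entryProd X ((q.2, q.1.headD i) :: stepsOf q.1)) (fun q => q.2)
    (fun q q' => q.1.toFinset = q'.1.toFinset) (fun _ _ => Eq.symm) _ ?_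
    (fun q _ => h.measurable_entryProd _) _ (fun q _ => listInd_nonneg _) (fun q hq => ?_) ?_
  · intro q hq
    have hq' := (mem_loopPairs.1 hq).1
    have hlen : q.1.toFinset.card ≤ n + 1 := by
      rw [← length_of_mem_walks (mem_walks_of_mem_saws hq')]
      exact List.toFinset_card_le _
    refine le_trans (Finset.card_le_card (t := ((saws i n).filter fun w' =>
      q.1.toFinset = w'.toFinset) ×ˢ q.1.toFinset) fun q' hq'' => ?_) ?_
    · simp only [Finset.mem_filter] at hq''
      obtain ⟨h1, h2⟩ := hq''
      have h3 := mem_loopPairs.1 h1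
      rw [Finset.mem_product, Finset.mem_filter]
      exact ⟨⟨h3.1, h2⟩, by rw [h2]; exact List.mem_toFinset.2 h3.2.1⟩
    · rw [Finset.card_product]
      exact Nat.mul_le_mul (by convert card_saws_filter_toFinset_le i n hq') hlen
  · obtain ⟨h1, h2, h3⟩ := mem_loopPairs.1 hq
    refine (h.lintegral_entryProd_sq_le (nodup_edgesOf_loop (nodup_of_mem_saws h1) h3)).trans ?_
    refine ENNReal.ofReal_le_ofReal ?_
    unfold listInd
    split_ifs with a b
    · exact le_rfl
    · exact absurd (fun p hp => a p (List.mem_cons_of_mem _ hp)) b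
    · norm_num
    · exact le_rfl
  · intro q hq q' hq' hne
    obtain ⟨h1, h2, h3⟩ := mem_loopPairs.1 hq
    obtain ⟨h1', h2', h3'⟩ := mem_loopPairs.1 hq'
    obtain ⟨x, hx, hx'⟩ := exists_mem_notMem_of_saws h1 h1' hne
    obtain ⟨y, hy⟩ := exists_mem_edgesOf_stepsOf (pos_of_saws_mem_notMem h1 h1' hx hx') hx
    refine h.integral_mul_star_eq_zero (h.centeredAt_entryProd (e := s(x, y)) ?_)
      (h.measurable_entryProd_sigmaOff ?_)
    · exact List.count_eq_one_of_mem (nodup_edgesOf_loop (nodup_of_mem_saws h1) h3)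
        (List.mem_cons_of_mem _ hy)
    -- The closing edge of `q'` joins two vertices of `q'`, so it cannot contain `x` either.
    · rw [edgesOf_cons, List.mem_cons, not_or]
      refine ⟨fun hc => ?_, notMem_edgesOf_stepsOf hx' y⟩
      obtain ⟨v, t, hvt⟩ := exists_cons_of_mem_walks (mem_walks_of_mem_saws h1')
      have hhead : q'.1.headD i ∈ q'.1 := by rw [hvt]; simp
      rcases Sym2.eq_iff.1 hc with ⟨hc', _⟩ | ⟨hc', _⟩
      · exact hx' (hc' ▸ h2')
      · exact hx' (hc' ▸ hhead)

theorem _root_.measurable_ofReal_sq_norm_sub (c : ℝ) :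
    Measurable (fun z : ℂ => ((‖z‖ ^ 2 - c : ℝ) : ℂ)) := by fun_prop

theorem centeredAt_sq_sub [IsProbabilityMeasure P] (h : IsSparseWigner P X W C α) (u v : Fin N) :
    CenteredAt P X s(u, v) (fun ω => ((‖X ω u v‖ ^ 2 - entryInd P X u v : ℝ) : ℂ)) := by
  refine ⟨_, fun _ => 1, ?_, measurable_const, ?_, fun ω => (mul_one _).symm⟩
  · exact (measurable_ofReal_sq_norm_sub _).comp (h.measurable_entry_comap u v)
  · have hi : Integrable (fun ω => ‖X ω u v‖ ^ 2) P := by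
      refine (memLp_two_iff_integrable_sq_norm (h.measurable u v).aestronglyMeasurable).1
        (integrable_sq_norm_of_lintegral_le (h.measurable u v) (b := 1) ?_).1
      simp only [h.enorm_entry, ENNReal.ofReal_one]
      exact h.lintegral_edgeVar_sq_le _
    rw [integral_complex_ofReal, integral_sub hi (integrable_const _)]
    simp only [integral_const, probReal_univ, one_smul, Complex.ofReal_eq_zero, sub_eq_zero]
    unfold entryInd
    split_ifs with hz
    · exact h.var u v hz
    · rw [EntryNonzero, not_not] at hz
      rw [integral_eq_zero_of_ae]
      filter_upwards [hz] with ω hω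
      simp [hω]

theorem measurable_sq_sub_sigmaOff (h : IsSparseWigner P X W C α) {u v : Fin N} {e : Sym2 (Fin N)}
    (he : s(u, v) ≠ e) :
    Measurable[sigmaOff X e] (fun ω => ((‖X ω u v‖ ^ 2 - entryInd P X u v : ℝ) : ℂ)) :=
  (measurable_ofReal_sq_norm_sub _).comp (h.measurable_entry_sigmaOff he)

theorem lintegral_fluctVec_le [IsProbabilityMeasure P] (h : IsSparseWigner P X W C α) (i : Fin N)
    (n : ℕ) {B : ℝ} (hB0 : 0 ≤ B) (hB : ∀ e, ∫⁻ ω, ‖edgeVar X e ω‖ₑ ^ 4 ∂P ≤ ENNReal.ofReal B) :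
    ∫⁻ ω, ∑ j, ‖fluctVec P X i n ω j‖ₑ ^ 2 ∂P
      ≤ ENNReal.ofReal ((n + 2).factorial *
          ∑ w ∈ saws i (n + 1), (B + 1) * listInd P X (stepsOf w)) := by
  have hform : ∀ w ∈ saws i (n + 1), ∃ u v t, w = u :: v :: t ∧ (u :: v :: t).Nodup := by
    intro w hw
    have hn := nodup_of_mem_saws hw
    obtain ⟨u, t, ht, rfl⟩ := mem_walks_succ.1 (mem_walks_of_mem_saws hw)
    obtain ⟨v, t', rfl⟩ := exists_cons_of_mem_walks ht
    exact ⟨u, v, t', rfl, hn⟩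
  refine lintegral_sum_enorm_sq_le (saws i (n + 1))
    (fun w ω => ((‖X ω (w.headD i) (w.tail.headD i)‖ ^ 2
      - entryInd P X (w.headD i) (w.tail.headD i) : ℝ) : ℂ) * entryProd X (stepsOf w.tail) ω)
    (fun w => w.tail.headD i)
    (fun w w' => w.toFinset = w'.toFinset) (fun _ _ => Eq.symm) _ ?_ (fun w _ => ?_) _
    (fun w _ => mul_nonneg (by linarith) (listInd_nonneg _)) (fun w hw => ?_) ?_
  · intro w hw
    convert card_saws_filter_toFinset_le i (n + 1) hw
  · exact ((measurable_ofReal_sq_norm_sub _).comp (h.measurable _ _)).mul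
      (h.measurable_entryProd _)
  · obtain ⟨u, v, t, rfl, hn⟩ := hform w hw
    exact h.lintegral_fluct_sq_le (p := (u, v)) (L := stepsOf (v :: t))
      (nodup_edgesOf_stepsOf hn) hB0 hB
  · intro w hw w' hw' hne
    obtain ⟨x, hx, hx'⟩ := exists_mem_notMem_of_saws hw hw' hne
    obtain ⟨y, hy⟩ := exists_mem_edgesOf_stepsOf (pos_of_saws_mem_notMem hw hw' hx hx') hx
    obtain ⟨u, v, t, rfl, hn⟩ := hform w hw
    obtain ⟨u', v', t', rfl, hn'⟩ := hform w' hw'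
    have hedge := nodup_edgesOf_stepsOf hn
    have hy' := notMem_edgesOf_stepsOf hx' y
    simp only [stepsOf_cons_cons, edgesOf_cons, List.mem_cons, not_or, List.nodup_cons]
      at hy hy' hedge
    simp only [List.headD_cons, List.tail_cons]
    refine h.integral_mul_star_eq_zero (e := s(x, y)) ?_
      (Measurable.mul (h.measurable_sq_sub_sigmaOff (Ne.symm hy'.1))
        (h.measurable_entryProd_sigmaOff hy'.2))
    -- The distinguishing edge may be the backtracked one, where the fluctuation is centred, or an
    -- earlier one, where the entry is centred.
    rcases hy with hy | hy
    · rw [hy]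
      exact (h.centeredAt_sq_sub u v).mul (h.measurable_entryProd_sigmaOff hedge.1)
    · have hne' : s(u, v) ≠ s(x, y) := fun hc => hedge.1 (hc ▸ hy)
      have := (h.centeredAt_entryProd (List.count_eq_one_of_mem hedge.2 hy)).mul
        (h.measurable_sq_sub_sigmaOff hne')
      simpa only [mul_comm] using this

end IsSparseWigner

/-! ### Normalization to the Chebyshev recursion. -/

section Normalized

variable {N : ℕ} {Ω : Type*}

/-- The sums over self-avoiding walks, normalized and shifted by one. -/
noncomputable def normSaw (X : Ω → Matrix (Fin N) (Fin N) ℂ) (c : ℝ) (i : Fin N) (ω : Ω) :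
    ℕ → Fin N → ℂ
  | 0 => 0
  | m + 1 => ((c : ℂ) ^ m)⁻¹ • sawVec X i m ω

/-- The error terms in the Chebyshev recursion for `normSaw`. -/
noncomputable def normErr [MeasurableSpace Ω] (P : Measure Ω) (X : Ω → Matrix (Fin N) (Fin N) ℂ) (W : ℕ) (c : ℝ)
    (i : Fin N) (ω : Ω) : ℕ → Fin N → ℂ
  | 0 => 0
  | 1 => (c : ℂ)⁻¹ • loopVec X i 0 ω
  | n + 2 => ((c : ℂ) ^ (n + 2))⁻¹ •
      (loopVec X i (n + 1) ω + fluctVec P X i n ω + defectVec P X W i n ω)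

theorem mulVec_normSaw [MeasurableSpace Ω] (P : Measure Ω) {X : Ω → Matrix (Fin N) (Fin N) ℂ}
    (hX : ∀ ω, (X ω).IsHermitian) {W : ℕ} {c : ℝ} (hc : 0 < c) (hcW : c ^ 2 = W) (i : Fin N)
    (ω : Ω) (m : ℕ) : (X ω).mulVec (normSaw X c i ω (m + 1))
      = (c : ℂ) • (normSaw X c i ω (m + 2) + normSaw X c i ω m + normErr P X W c i ω (m + 1)) := by
  have hc' : (c : ℂ) ≠ 0 := by exact_mod_cast hc.ne'
  have hW' : (W : ℂ) = (c : ℂ) ^ 2 := by exact_mod_cast hcW.symm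
  match m with
  | 0 =>
    simp only [normSaw, normErr, Matrix.mulVec_smul, mulVec_sawVec_zero]
    simp only [pow_zero, inv_one, one_smul, pow_one, add_zero, smul_add, smul_smul,
      mul_inv_cancel₀ hc']
  | n + 1 =>
    simp only [normSaw, normErr, Matrix.mulVec_smul, mulVec_sawVec_succ P X hX W, smul_add,
      smul_smul, hW']
    have e1 : (c : ℂ) * ((c : ℂ) ^ (n + 2))⁻¹ = ((c : ℂ) ^ (n + 1))⁻¹ := by
      field_simp
      ring
    have e2 : ((c : ℂ) ^ (n + 1))⁻¹ * (c : ℂ) ^ 2 = (c : ℂ) * ((c : ℂ) ^ n)⁻¹ := by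
      field_simp
      ring
    simp only [add_assoc, e1, e2]

theorem mem_of_mem_walks {i : Fin N} {n : ℕ} : ∀ {w}, w ∈ walks i n → i ∈ w := by
  induction n with
  | zero => intro w hw; simp [walks] at hw; simp [hw]
  | succ n ih =>
    intro w hw
    obtain ⟨u, t, ht, rfl⟩ := mem_walks_succ.1 hw
    exact List.mem_cons_of_mem _ (ih ht)

theorem star_normSaw_one_dotProduct (X : Ω → Matrix (Fin N) (Fin N) ℂ) (c : ℝ) (i : Fin N) (ω : Ω)
    (m : ℕ) : star (normSaw X c i ω 1) ⬝ᵥ normSaw X c i ω m = if m = 1 then 1 else 0 := by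
  have h0 : ∀ j, sawVec X i 0 ω j = if i = j then 1 else 0 := by
    intro j
    have hs : saws i 0 = {[i]} := by simp [saws, walks, Finset.filter_singleton]
    rw [sawVec, hs, Finset.sum_singleton]
    rfl
  have h1 : ∀ x : Fin N → ℂ, star (normSaw X c i ω 1) ⬝ᵥ x = x i := by
    intro x
    simp [normSaw, dotProduct, h0, apply_ite (star : ℂ → ℂ)]
  rw [h1]
  match m with
  | 0 => simp [normSaw]
  | 1 => simp [normSaw, h0]
  | m + 2 =>
    -- A self-avoiding walk of positive length does not return to `i`, so its endpoint vector is
    -- orthogonal to the first one.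
    have : sawVec X i (m + 1) ω i = 0 := by
      refine Finset.sum_eq_zero fun w hw => ?_
      have hn := nodup_of_mem_saws hw
      obtain ⟨u, t, ht, rfl⟩ := mem_walks_succ.1 (mem_walks_of_mem_saws hw)
      have hi := mem_of_mem_walks ht
      rw [if_neg]
      rw [List.headD_cons]
      rintro rfl
      exact (List.nodup_cons.1 hn).1 hi
    simp [normSaw, this]

end Normalized

/-! ### Counting walks along nonzero entries, summed over the starting point. -/

namespace IsSparseWigner

variable {N : ℕ} {Ω : Type*} [MeasurableSpace Ω] {P : Measure Ω}
  {X : Ω → Matrix (Fin N) (Fin N) ℂ} {W : ℕ} {C α : ℝ}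

theorem _root_.entryInd_nonneg (u v : Fin N) : 0 ≤ entryInd P X u v := by
  unfold entryInd; split_ifs <;> norm_num

theorem _root_.listInd_cons (p : Fin N × Fin N) (L : List (Fin N × Fin N)) :
    listInd P X (p :: L) = entryInd P X p.1 p.2 * listInd P X L := by
  have : (∀ q ∈ p :: L, EntryNonzero P X q.1 q.2) ↔
      EntryNonzero P X p.1 p.2 ∧ ∀ q ∈ L, EntryNonzero P X q.1 q.2 := by simp
  unfold listInd entryInd
  by_cases h1 : EntryNonzero P X p.1 p.2
  · by_cases h2 : ∀ q ∈ L, EntryNonzero P X q.1 q.2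
    · rw [if_pos (this.2 ⟨h1, h2⟩), if_pos h1, if_pos h2, one_mul]
    · rw [if_neg fun hc => h2 (this.1 hc).2, if_neg h2, mul_zero]
  · rw [if_neg fun hc => h1 (this.1 hc).1, if_neg h1, zero_mul]

theorem _root_.sum_entryInd_eq_rowCount (u : Fin N) :
    ∑ v, entryInd P X u v = rowCount P X u := by
  classical
  unfold entryInd
  rw [Finset.sum_boole, rowCount, Set.ncard_eq_toFinset_card']
  congr 2
  ext v
  simp

theorem entryInd_comm (h : IsSparseWigner P X W C α) (u v : Fin N) :
    entryInd P X u v = entryInd P X v u := by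
  unfold entryInd
  congr 1
  exact propext ⟨h.entryNonzero_comm, h.entryNonzero_comm⟩

/-- Averaged over the starting point, the endpoint of a walk is at most uniformly distributed. -/
theorem sum_walks_listInd_le (h : IsSparseWigner P X W C α) (n : ℕ) :
    ∀ g : Fin N → ℝ, (∀ v, 0 ≤ g v) →
      ∑ i, ∑ w ∈ walks i n, listInd P X (stepsOf w) * g (w.headD i) ≤ W ^ n * ∑ v, g v := by
  induction n with
  | zero => intro g _; simp [walks, listInd]
  | succ n ih =>
    intro g hg
    have e1 : ∀ i, ∑ w ∈ walks i (n + 1), listInd P X (stepsOf w) * g (w.headD i)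
        = ∑ w ∈ walks i n, listInd P X (stepsOf w) * ∑ u, entryInd P X u (w.headD i) * g u := by
      intro i
      rw [sum_walks_succ]
      refine Finset.sum_congr rfl fun w hw => ?_
      rw [Finset.mul_sum]
      refine Finset.sum_congr rfl fun u _ => ?_
      rw [stepsOf_cons_of_mem_walks hw, listInd_cons, List.headD_cons]
      ring
    simp only [e1]
    refine (ih (fun v => ∑ u, entryInd P X u v * g u) fun v => Finset.sum_nonneg fun u _ =>
      mul_nonneg (entryInd_nonneg _ _) (hg u)).trans ?_
    rw [pow_succ, mul_assoc]
    refine mul_le_mul_of_nonneg_left ?_ (by positivity)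
    rw [Finset.sum_comm, Finset.mul_sum]
    refine Finset.sum_le_sum fun u _ => ?_
    rw [← Finset.sum_mul, sum_entryInd_eq_rowCount]
    exact mul_le_mul_of_nonneg_right (by exact_mod_cast h.row_le u) (hg u)

theorem sum_saws_listInd_mul_le (h : IsSparseWigner P X W C α) (n : ℕ) (g : Fin N → ℝ)
    (hg : ∀ v, 0 ≤ g v) :
    ∑ i, ∑ w ∈ saws i n, listInd P X (stepsOf w) * g (w.headD i) ≤ W ^ n * ∑ v, g v := by
  refine le_trans (Finset.sum_le_sum fun i _ => ?_) (h.sum_walks_listInd_le n g hg)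
  exact Finset.sum_le_sum_of_subset_of_nonneg (Finset.filter_subset _ _)
    fun w _ _ => mul_nonneg (listInd_nonneg _) (hg _)

theorem sum_saws_listInd_le (h : IsSparseWigner P X W C α) (n : ℕ) :
    ∑ i, ∑ w ∈ saws i n, listInd P X (stepsOf w) ≤ W ^ n * N := by
  simpa using h.sum_saws_listInd_mul_le n (fun _ => 1) fun _ => zero_le_one

/-- Closing a loop leaves at most `n + 1` choices instead of `W`; this gains the factor `1 / W` in
the error. -/
theorem sum_loopPairs_listInd_le (h : IsSparseWigner P X W C α) (n : ℕ) :
    ∑ i, ∑ q ∈ loopPairs i n, listInd P X (stepsOf q.1) ≤ (n + 1) * (W ^ n * N) := by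
  refine le_trans ?_ (mul_le_mul_of_nonneg_left (h.sum_saws_listInd_le n) (by positivity))
  rw [Finset.mul_sum]
  refine Finset.sum_le_sum fun i _ => ?_
  rw [loopPairs, Finset.sum_filter, Finset.sum_product, Finset.mul_sum]
  refine Finset.sum_le_sum fun w hw => ?_
  dsimp only
  rw [← Finset.sum_filter, Finset.sum_const, nsmul_eq_mul]
  refine mul_le_mul_of_nonneg_right ?_ (listInd_nonneg _)
  have : (Finset.univ.filter fun a => a ∈ w ∧ w.tail.head? ≠ some a).card ≤ w.toFinset.card :=
    Finset.card_le_card fun a ha => List.mem_toFinset.2 (Finset.mem_filter.1 ha).2.1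
  have h2 := this.trans (List.toFinset_card_le w)
  rw [length_of_mem_walks (mem_walks_of_mem_saws hw)] at h2
  exact_mod_cast h2

open Classical in
-- The defect has two sources: a row with too few nonzero entries, losing at most `W`, and the
-- exclusion of the `n + 1` visited vertices.
theorem degreeDefect_sq_le (h : IsSparseWigner P X W C α) {i : Fin N} {n : ℕ} {w : List (Fin N)}
    (hw : w ∈ saws i n) : degreeDefect P X W i w ^ 2
      ≤ 2 * W ^ 2 * (if rowCount P X (w.headD i) ≠ W then 1 else 0) + 2 * (n + 1) ^ 2 := by
  set v := w.headD i
  have e1 : (∑ u, if u ∈ w then 0 else entryInd P X u v)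
      = rowCount P X v - ∑ u, if u ∈ w then entryInd P X u v else 0 := by
    rw [← sum_entryInd_eq_rowCount, ← Finset.sum_sub_distrib]
    refine Finset.sum_congr rfl fun u _ => ?_
    rw [h.entryInd_comm v u]
    split_ifs <;> ring
  have e2 : 0 ≤ ∑ u, if u ∈ w then entryInd P X u v else 0 := by
    refine Finset.sum_nonneg fun u _ => ?_
    split_ifs
    · exact entryInd_nonneg _ _
    · exact le_rfl
  have e3 : ∑ u, (if u ∈ w then entryInd P X u v else 0) ≤ n + 1 := by
    calc _ ≤ ∑ u, if u ∈ w.toFinset then (1 : ℝ) else 0 := by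
          refine Finset.sum_le_sum fun u _ => ?_
          simp only [List.mem_toFinset]
          split_ifs
          · unfold entryInd; split_ifs <;> norm_num
          · exact le_rfl
      _ ≤ _ := by
          rw [Finset.sum_boole, Finset.filter_mem_eq_inter, Finset.univ_inter]
          have := List.toFinset_card_le w
          rw [length_of_mem_walks (mem_walks_of_mem_saws hw)] at this
          exact_mod_cast this
  have e4 : (rowCount P X v : ℝ) ≤ W := by exact_mod_cast h.row_le v
  have e5 : (0 : ℝ) ≤ rowCount P X v := Nat.cast_nonneg _
  rw [degreeDefect, e1]
  set x := ∑ u, if u ∈ w then entryInd P X u v else 0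
  split_ifs with hv
  · nlinarith [sq_nonneg ((W : ℝ) - rowCount P X v - x)]
  · rw [not_not.1 hv]
    nlinarith

theorem sum_defect_le (h : IsSparseWigner P X W C α) (n : ℕ) :
    ∑ i, ∑ w ∈ saws i n, listInd P X (stepsOf w) * degreeDefect P X W i w ^ 2
      ≤ W ^ n * (2 * W ^ 2 * {i : Fin N | rowCount P X i ≠ W}.ncard + 2 * (n + 1) ^ 2 * N) := by
  classical
  refine le_trans (Finset.sum_le_sum fun i _ => Finset.sum_le_sum fun w hw =>
    mul_le_mul_of_nonneg_left (h.degreeDefect_sq_le hw) (listInd_nonneg _)) ?_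
  refine (h.sum_saws_listInd_mul_le n (fun v => 2 * W ^ 2 *
    (if rowCount P X v ≠ W then 1 else 0) + 2 * (n + 1) ^ 2) fun v => ?_).trans (le_of_eq ?_)
  · split_ifs <;> positivity
  · rw [Finset.sum_add_distrib, ← Finset.mul_sum, Finset.sum_boole, Set.ncard_eq_toFinset_card']
    simp
    left
    ring

end IsSparseWigner

/-! ### Squared norms and inner products in `[0, ∞]`. -/

section SqNorm

variable {N : ℕ}

/-- The squared Euclidean norm with values in `[0, ∞]`. -/
noncomputable def sqNorm (v : Fin N → ℂ) : ENNReal := ∑ j, ‖v j‖ₑ ^ 2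

theorem sqNorm_smul (a : ℂ) (v : Fin N → ℂ) : sqNorm (a • v) = ‖a‖ₑ ^ 2 * sqNorm v := by
  simp only [sqNorm, Pi.smul_apply, smul_eq_mul, enorm_mul, mul_pow, Finset.mul_sum]

theorem sqNorm_add_add_le (x y z : Fin N → ℂ) :
    sqNorm (x + y + z) ≤ 3 * (sqNorm x + sqNorm y + sqNorm z) := by
  simp only [sqNorm, ← Finset.sum_add_distrib, Finset.mul_sum]
  refine Finset.sum_le_sum fun j _ => ?_
  have h3 : (3 : ENNReal) = ENNReal.ofReal 3 := by simp
  simp only [Pi.add_apply, ← ofReal_norm, ← ENNReal.ofReal_pow (norm_nonneg _)]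
  rw [← ENNReal.ofReal_add (by positivity) (by positivity),
    ← ENNReal.ofReal_add (by positivity) (by positivity), h3, ← ENNReal.ofReal_mul (by norm_num)]
  refine ENNReal.ofReal_le_ofReal ?_
  have := norm_add₃_le (a := x j) (b := y j) (c := z j)
  have h0 : 0 ≤ ‖x j + y j + z j‖ := norm_nonneg _
  nlinarith [sq_nonneg (‖x j‖ - ‖y j‖), sq_nonneg (‖x j‖ - ‖z j‖), sq_nonneg (‖y j‖ - ‖z j‖)]

/-- This form of Cauchy–Schwarz is linear in the squared norms, so it can be integrated and summed
directly; `τ` is tuned at the end. -/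
theorem enorm_star_dotProduct_le (x y : Fin N → ℂ) {τ : ℝ} (hτ : 0 < τ) :
    ‖star x ⬝ᵥ y‖ₑ ≤ ENNReal.ofReal τ * sqNorm x + ENNReal.ofReal τ⁻¹ * sqNorm y := by
  simp only [sqNorm, Finset.mul_sum, ← Finset.sum_add_distrib, dotProduct]
  refine (enorm_sum_le _ _).trans (Finset.sum_le_sum fun j _ => ?_)
  simp only [← ofReal_norm, ← ENNReal.ofReal_pow (norm_nonneg _), Pi.star_apply, norm_mul,
    norm_star]
  rw [← ENNReal.ofReal_mul hτ.le, ← ENNReal.ofReal_mul (by positivity),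
    ← ENNReal.ofReal_add (by positivity) (by positivity)]
  refine ENNReal.ofReal_le_ofReal ?_
  have h1 : 0 ≤ τ⁻¹ * (τ * ‖x j‖ - ‖y j‖) ^ 2 := by positivity
  have h2 : τ⁻¹ * (τ * ‖x j‖ - ‖y j‖) ^ 2
      = τ * ‖x j‖ ^ 2 + τ⁻¹ * ‖y j‖ ^ 2 - 2 * (‖x j‖ * ‖y j‖) := by
    field_simp
    ring
  have h3 : 0 ≤ ‖x j‖ * ‖y j‖ := by positivity
  linarith

end SqNorm

/-! ### Averaged error bounds and the lower tail. -/

namespace IsSparseWigner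

variable {N : ℕ} {Ω : Type*} [MeasurableSpace Ω] {P : Measure Ω}
  {X : Ω → Matrix (Fin N) (Fin N) ℂ} {W : ℕ} {C α : ℝ}

theorem _root_.measurable_sqNorm {V : Ω → Fin N → ℂ} (hV : Measurable V) :
    Measurable (fun ω => sqNorm (V ω)) :=
  Finset.measurable_fun_sum _ fun j _ => ((measurable_pi_iff.1 hV j).enorm.pow_const 2)

theorem measurable_sawVec (h : IsSparseWigner P X W C α) (i : Fin N) (n : ℕ) :
    Measurable (sawVec X i n) := by
  refine measurable_pi_iff.2 fun j => Finset.measurable_fun_sum _ fun w _ => ?_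
  split_ifs
  · exact h.measurable_entryProd _
  · exact measurable_const

theorem measurable_loopVec (h : IsSparseWigner P X W C α) (i : Fin N) (n : ℕ) :
    Measurable (loopVec X i n) := by
  refine measurable_pi_iff.2 fun j => Finset.measurable_fun_sum _ fun w _ => ?_
  split_ifs
  · exact h.measurable_entryProd _
  · exact measurable_const

theorem measurable_fluctVec (h : IsSparseWigner P X W C α) (i : Fin N) (n : ℕ) :
    Measurable (fluctVec P X i n) := by
  refine measurable_pi_iff.2 fun j => Finset.measurable_fun_sum _ fun w _ => ?_
  split_ifs
  · exact ((measurable_ofReal_sq_norm_sub _).comp (h.measurable _ _)).mul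
      (h.measurable_entryProd _)
  · exact measurable_const

theorem measurable_defectVec (h : IsSparseWigner P X W C α) (i : Fin N) (n : ℕ) :
    Measurable (defectVec P X W i n) := by
  refine measurable_pi_iff.2 fun j => Finset.measurable_fun_sum _ fun w _ => ?_
  split_ifs
  · exact (h.measurable_entryProd _).mul_const _
  · exact measurable_const

theorem measurable_normSaw (h : IsSparseWigner P X W C α) (c : ℝ) (i : Fin N) (m : ℕ) :
    Measurable (fun ω => normSaw X c i ω m) := by
  match m with
  | 0 => exact measurable_const
  | m + 1 => exact (h.measurable_sawVec i m).const_smul ((c : ℂ) ^ m)⁻¹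

theorem measurable_normErr (h : IsSparseWigner P X W C α) (c : ℝ) (i : Fin N) (m : ℕ) :
    Measurable (fun ω => normErr P X W c i ω m) := by
  match m with
  | 0 => exact measurable_const
  | 1 => exact (h.measurable_loopVec i 0).const_smul (c : ℂ)⁻¹
  | n + 2 =>
    exact (((h.measurable_loopVec i (n + 1)).add (h.measurable_fluctVec i n)).add
      (h.measurable_defectVec i n)).const_smul ((c : ℂ) ^ (n + 2))⁻¹

theorem _root_.enorm_inv_pow_sq {c : ℝ} (hc : 0 < c) (m : ℕ) :
    ‖((c : ℂ) ^ m)⁻¹‖ₑ ^ 2 = ENNReal.ofReal ((c ^ 2) ^ m)⁻¹ := by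
  rw [← ofReal_norm, ← ENNReal.ofReal_pow (norm_nonneg _), norm_inv, norm_pow, Complex.norm_real,
    Real.norm_of_nonneg hc.le, inv_pow, ← pow_mul, ← pow_mul, mul_comm]

theorem sum_lintegral_sqNorm_normSaw_le [IsProbabilityMeasure P] (h : IsSparseWigner P X W C α)
    {c : ℝ} (hc : 0 < c) (hcW : c ^ 2 = W) (m : ℕ) :
    ∑ i, ∫⁻ ω, sqNorm (normSaw X c i ω m) ∂P ≤ ENNReal.ofReal (m.factorial * N) := by
  match m with
  | 0 => simp [normSaw, sqNorm]
  | m + 1 =>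
    have hW : (0 : ℝ) < W := by rw [← hcW]; positivity
    simp only [normSaw, sqNorm_smul, enorm_inv_pow_sq hc, hcW]
    have e1 : ∀ i, ∫⁻ ω, ENNReal.ofReal ((W : ℝ) ^ m)⁻¹ * sqNorm (sawVec X i m ω) ∂P
        ≤ ENNReal.ofReal (((W : ℝ) ^ m)⁻¹ *
          ((m + 1).factorial * ∑ w ∈ saws i m, listInd P X (stepsOf w))) := by
      intro i
      rw [lintegral_const_mul' _ _ ENNReal.ofReal_ne_top, ENNReal.ofReal_mul (by positivity)]
      exact mul_le_mul_right (h.lintegral_sawVec_le i m) _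
    refine (Finset.sum_le_sum fun i _ => e1 i).trans ?_
    rw [← ENNReal.ofReal_sum_of_nonneg fun i _ => mul_nonneg (by positivity)
      (mul_nonneg (by positivity) (Finset.sum_nonneg fun w _ => listInd_nonneg _))]
    refine ENNReal.ofReal_le_ofReal ?_
    rw [← Finset.mul_sum, ← Finset.mul_sum]
    calc _ ≤ ((W : ℝ) ^ m)⁻¹ * ((m + 1).factorial * (W ^ m * N)) := by
          gcongr
          exact h.sum_saws_listInd_le m
      _ = _ := by field_simp

/-- The constant in the bound on the error terms. -/
noncomputable def _root_.errConst (B : ℝ) (m : ℕ) : ℝ := 12 * m.factorial * (m ^ 2 + B + 1)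

/-- Relative to the normalization, loops, fluctuations and visited vertices all lose at least one
power of `W`, giving `N / W`. Only deficient rows lose none, but they are few, because the endpoint
of an averaged walk is at most uniformly distributed. -/
theorem sum_lintegral_sqNorm_normErr_le [IsProbabilityMeasure P] (h : IsSparseWigner P X W C α)
    {c : ℝ} (hc : 0 < c) (hcW : c ^ 2 = W) {B : ℝ} (hB0 : 0 ≤ B)
    (hB : ∀ e, ∫⁻ ω, ‖edgeVar X e ω‖ₑ ^ 4 ∂P ≤ ENNReal.ofReal B) (m : ℕ) :
    ∑ i, ∫⁻ ω, sqNorm (normErr P X W c i ω m) ∂P ≤ ENNReal.ofReal (errConst B m *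
      (N / W + {i : Fin N | rowCount P X i ≠ W}.ncard)) := by
  have hW : (0 : ℝ) < W := by rw [← hcW]; positivity
  have hW1 : (1 : ℝ) ≤ W := by
    have : 0 < W := by exact_mod_cast hW
    exact_mod_cast this
  set b : ℝ := ({i : Fin N | rowCount P X i ≠ W}.ncard : ℝ) with hb
  have hb0 : 0 ≤ b := Nat.cast_nonneg _
  have hlp : ∀ i n, 0 ≤ ∑ q ∈ loopPairs i n, listInd P X (stepsOf q.1) :=
    fun i n => Finset.sum_nonneg fun w _ => listInd_nonneg _
  match m with
  | 0 => simp [normErr, sqNorm]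
  | 1 =>
    have e0 := enorm_inv_pow_sq hc 1
    rw [pow_one, pow_one, hcW] at e0
    simp only [normErr, sqNorm_smul, e0]
    have e1 : ∀ i, ∫⁻ ω, ENNReal.ofReal (W : ℝ)⁻¹ * sqNorm (loopVec X i 0 ω) ∂P
        ≤ ENNReal.ofReal ((W : ℝ)⁻¹ * (((0 + 1).factorial * (0 + 1) : ℕ) *
          ∑ q ∈ loopPairs i 0, listInd P X (stepsOf q.1))) := by
      intro i
      rw [lintegral_const_mul' _ _ ENNReal.ofReal_ne_top, ENNReal.ofReal_mul (by positivity)]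
      exact mul_le_mul_right (h.lintegral_loopVec_le i 0) _
    refine (Finset.sum_le_sum fun i _ => e1 i).trans ?_
    rw [← ENNReal.ofReal_sum_of_nonneg fun i _ => mul_nonneg (by positivity)
      (mul_nonneg (by positivity) (hlp i 0))]
    refine ENNReal.ofReal_le_ofReal ?_
    rw [← Finset.mul_sum, ← Finset.mul_sum]
    have e2 := h.sum_loopPairs_listInd_le 0
    norm_num [Nat.factorial] at e2 ⊢
    calc _ ≤ (W : ℝ)⁻¹ * N := by gcongr
      _ = 1 * (N / W + 0) := by ring
      _ ≤ errConst B 1 * (N / W + b) := by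
          have : 1 ≤ errConst B 1 := by
            norm_num [errConst]
            linarith
          gcongr
  | n + 2 =>
    simp only [normErr, sqNorm_smul, enorm_inv_pow_sq hc, hcW]
    set L1 : Fin N → ℝ := fun i => ((n + 1 + 1).factorial * (n + 1 + 1) : ℕ) *
          ∑ q ∈ loopPairs i (n + 1), listInd P X (stepsOf q.1)
    set L2 : Fin N → ℝ := fun i => (n + 2).factorial *
          ∑ w ∈ saws i (n + 1), (B + 1) * listInd P X (stepsOf w)
    set L3 : Fin N → ℝ := fun i => (n + 1).factorial * ∑ w ∈ saws i n,
          listInd P X (stepsOf w) * degreeDefect P X W i w ^ 2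
    have l1 : ∀ i, 0 ≤ L1 i := fun i => mul_nonneg (by positivity) (hlp i _)
    have l2 : ∀ i, 0 ≤ L2 i := fun i => mul_nonneg (by positivity) (Finset.sum_nonneg fun w _ =>
      mul_nonneg (by positivity) (listInd_nonneg _))
    have l3 : ∀ i, 0 ≤ L3 i := fun i => mul_nonneg (by positivity) (Finset.sum_nonneg fun w _ =>
      mul_nonneg (listInd_nonneg _) (sq_nonneg _))
    have e1 : ∀ i, ∫⁻ ω, ENNReal.ofReal ((W : ℝ) ^ (n + 2))⁻¹ *
        sqNorm (loopVec X i (n + 1) ω + fluctVec P X i n ω + defectVec P X W i n ω) ∂P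
        ≤ ENNReal.ofReal (((W : ℝ) ^ (n + 2))⁻¹ * (3 * (L1 i + L2 i + L3 i))) := by
      intro i
      have h3 : (3 : ENNReal) = ENNReal.ofReal 3 := by simp
      have s12 : 0 ≤ L1 i + L2 i := add_nonneg (l1 i) (l2 i)
      rw [lintegral_const_mul' _ _ ENNReal.ofReal_ne_top, ENNReal.ofReal_mul (by positivity),
        ENNReal.ofReal_mul (by norm_num), ENNReal.ofReal_add s12 (l3 i),
        ENNReal.ofReal_add (l1 i) (l2 i), ← h3]
      refine mul_le_mul_right ?_ _
      refine (lintegral_mono fun ω => sqNorm_add_add_le _ _ _).trans ?_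
      have m12 : Measurable (fun ω => sqNorm (loopVec X i (n + 1) ω) + sqNorm (fluctVec P X i n ω)) :=
        (measurable_sqNorm (h.measurable_loopVec i (n + 1))).add
          (measurable_sqNorm (h.measurable_fluctVec i n))
      rw [lintegral_const_mul' _ _ (by simp), lintegral_add_left m12,
        lintegral_add_left (measurable_sqNorm (h.measurable_loopVec i (n + 1)))]
      gcongr
      · exact h.lintegral_loopVec_le i (n + 1)
      · exact h.lintegral_fluctVec_le i n hB0 hB
      · exact h.lintegral_defectVec_le i n
    refine (Finset.sum_le_sum fun i _ => e1 i).trans ?_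
    rw [← ENNReal.ofReal_sum_of_nonneg fun i _ => mul_nonneg (by positivity)
      (mul_nonneg (by norm_num) (add_nonneg (add_nonneg (l1 i) (l2 i)) (l3 i)))]
    refine ENNReal.ofReal_le_ofReal ?_
    rw [← Finset.mul_sum, ← Finset.mul_sum, Finset.sum_add_distrib, Finset.sum_add_distrib]
    set F : ℝ := ((Nat.factorial (n + 2) : ℕ) : ℝ) with hF
    have hF' : ((n + 1).factorial : ℝ) ≤ F := by
      rw [hF]; exact_mod_cast Nat.factorial_le (by omega)
    have hF0 : 0 ≤ F := by rw [hF]; positivity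
    have t1 : ∑ i, L1 i ≤ F * (n + 2) ^ 2 * (W ^ (n + 1) * N) := by
      simp only [L1, ← Finset.mul_sum]
      have := h.sum_loopPairs_listInd_le (n + 1)
      push_cast at this ⊢
      calc _ ≤ (F * (n + 1 + 1)) * ((n + 1 + 1) * (W ^ (n + 1) * N)) := by
            gcongr
        _ = _ := by ring
    have t2 : ∑ i, L2 i ≤ F * (B + 1) * (W ^ (n + 1) * N) := by
      simp only [L2, ← Finset.mul_sum]
      rw [mul_assoc F]
      gcongr
      exact h.sum_saws_listInd_le (n + 1)
    have t3 : ∑ i, L3 i ≤ F * (W ^ n * (2 * W ^ 2 * b + 2 * (n + 1) ^ 2 * N)) := by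
      simp only [L3, ← Finset.mul_sum]
      have := h.sum_defect_le n
      calc _ ≤ ((n + 1).factorial : ℝ) *
            (W ^ n * (2 * W ^ 2 * b + 2 * (n + 1) ^ 2 * N)) := by gcongr
        _ ≤ _ := by gcongr
    calc _ ≤ ((W : ℝ) ^ (n + 2))⁻¹ * (3 * (F * (n + 2) ^ 2 * (W ^ (n + 1) * N)
          + F * (B + 1) * (W ^ (n + 1) * N)
          + F * (W ^ n * (2 * W ^ 2 * b + 2 * (n + 1) ^ 2 * N)))) := by gcongr
      _ = 3 * F * (((n + 2) ^ 2 + B + 1) * (N / W) + 2 * b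
          + 2 * (n + 1) ^ 2 * (N / W) * (1 / W)) := by
          field_simp
          ring
      _ ≤ 3 * F * (((n + 2) ^ 2 + B + 1) * (N / W) + 2 * b + 2 * (n + 1) ^ 2 * (N / W) * 1) := by
          gcongr
          rw [div_le_one hW]; exact hW1
      _ ≤ errConst B (n + 2) * (N / W + b) := by
          rw [errConst, ← hF]
          push_cast
          have hn : (0 : ℝ) ≤ n := Nat.cast_nonneg _
          have hx : (0 : ℝ) ≤ N / W := by positivity
          have hq : 1 ≤ ((n : ℝ) + 2) ^ 2 + B + 1 := by nlinarith
          rw [show 12 * F * (((n : ℝ) + 2) ^ 2 + B + 1) * (N / W + b)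
            = 3 * F * (4 * (((n : ℝ) + 2) ^ 2 + B + 1) * (N / W + b)) by ring]
          refine mul_le_mul_of_nonneg_left ?_ (by positivity)
          have p1 : ((n : ℝ) + 1) ^ 2 * (N / W) ≤ (((n : ℝ) + 2) ^ 2 + B + 1) * (N / W) := by
            refine mul_le_mul_of_nonneg_right ?_ hx
            nlinarith
          have p2 : 1 * b ≤ (((n : ℝ) + 2) ^ 2 + B + 1) * b :=
            mul_le_mul_of_nonneg_right hq hb0
          have p3 : 0 ≤ (((n : ℝ) + 2) ^ 2 + B + 1) * (N / W) := by positivity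
          nlinarith

/-- The lower tail of the largest eigenvalue: the bound holds for all `τ > 0`. -/
theorem measure_lambdaMax_lt_le [IsProbabilityMeasure P] (h : IsSparseWigner P X W C α)
    (hN : 0 < N) (hW0 : 0 < W) {B : ℝ} (hB0 : 0 ≤ B)
    (hB : ∀ e, ∫⁻ ω, ‖edgeVar X e ω‖ₑ ^ 4 ∂P ≤ ENNReal.ofReal B) {d : ℕ} (hd : 1 ≤ d)
    {δ : ℝ} (hδ : 0 < δ) (hdδ : (d : ℝ) ^ 2 * 4 ^ d * δ ≤ 1 / 2) {τ : ℝ} (hτ : 0 < τ) :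
    P {ω | lambdaMax (h.herm ω) < √W * (2 - 8 / d)} ≤ ENNReal.ofReal
      (∑ m ∈ Finset.range (2 * d + 2), (τ * m.factorial + τ⁻¹ * (errConst B m *
        (1 / W + {i : Fin N | rowCount P X i ≠ W}.ncard / N))) / δ) := by
  have hW : (0 : ℝ) < W := by exact_mod_cast hW0
  have hN' : (0 : ℝ) < N := by exact_mod_cast hN
  have hc : 0 < √(W : ℝ) := Real.sqrt_pos.2 hW
  have hcW : √(W : ℝ) ^ 2 = W := Real.sq_sqrt hW.le
  set c := √(W : ℝ)
  set b : ℝ := ({i : Fin N | rowCount P X i ≠ W}.ncard : ℝ)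
  have hb0 : 0 ≤ b := Nat.cast_nonneg _
  set F : Fin N → Ω → ENNReal := fun i ω => ∑ m ∈ Finset.range (2 * d + 2),
    (ENNReal.ofReal τ * sqNorm (normSaw X c i ω m)
      + ENNReal.ofReal τ⁻¹ * sqNorm (normErr P X W c i ω m)) with hF
  have ms : ∀ i m, Measurable (fun ω => sqNorm (normSaw X c i ω m)) :=
    fun i m => measurable_sqNorm (h.measurable_normSaw c i m)
  have mr : ∀ i m, Measurable (fun ω => sqNorm (normErr P X W c i ω m)) :=
    fun i m => measurable_sqNorm (h.measurable_normErr c i m)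
  have hFm : ∀ i, Measurable (F i) := fun i => Finset.measurable_fun_sum _ fun m _ =>
    ((ms i m).const_mul _).add ((mr i m).const_mul _)
  set bad := {ω | lambdaMax (h.herm ω) < c * (2 - 8 / d)}
  -- The bad event does not involve `i`, so on it the test vector must fail for every starting
  -- point. Summing Markov's inequality over `i` therefore bounds `N * P bad` by quantities
  -- controlled on average only.
  have hsub : ∀ i, bad ⊆ {ω | ENNReal.ofReal δ ≤ F i ω} := by
    intro i ω hω
    by_contra hlt
    simp only [Set.mem_ofPred_eq, not_le] at hlt
    refine absurd (lambdaMax_ge_of_chebyshev (h.herm ω) hc hδ.le (normSaw X c i ω)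
      (normErr P X W c i ω) hd rfl (mulVec_normSaw P h.herm hc hcW i ω)
      (star_normSaw_one_dotProduct X c i ω) (fun l m hl hm => ?_) hdδ) (not_le.2 hω)
    rw [← ENNReal.ofReal_le_ofReal_iff hδ.le, ofReal_norm]
    refine (enorm_star_dotProduct_le _ _ hτ).trans (le_trans ?_ hlt.le)
    simp only [hF, Finset.sum_add_distrib]
    exact add_le_add
      (Finset.single_le_sum (f := fun m => ENNReal.ofReal τ * sqNorm (normSaw X c i ω m))
        (fun _ _ => zero_le) (Finset.mem_range.2 (by omega)))
      (Finset.single_le_sum (f := fun m => ENNReal.ofReal τ⁻¹ * sqNorm (normErr P X W c i ω m))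
        (fun _ _ => zero_le) (Finset.mem_range.2 (by omega)))
  have h1 : ∀ i, ENNReal.ofReal δ * P bad ≤ ∫⁻ ω, F i ω ∂P := fun i =>
    (mul_le_mul_right (measure_mono (hsub i)) _).trans (mul_meas_ge_le_lintegral (hFm i) _)
  have h2 : (N : ENNReal) * (ENNReal.ofReal δ * P bad) ≤ ∑ i, ∫⁻ ω, F i ω ∂P := by
    calc _ = ∑ _i : Fin N, ENNReal.ofReal δ * P bad := by simp
      _ ≤ _ := Finset.sum_le_sum fun i _ => h1 i
  have hE : ∀ m, 0 ≤ errConst B m := fun m => by unfold errConst; positivity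
  have h3 : ∑ i, ∫⁻ ω, F i ω ∂P ≤ ENNReal.ofReal (∑ m ∈ Finset.range (2 * d + 2),
      (τ * (m.factorial * N) + τ⁻¹ * (errConst B m * (N / W + b)))) := by
    have e1 : ∀ i, ∫⁻ ω, F i ω ∂P = ∑ m ∈ Finset.range (2 * d + 2),
        (ENNReal.ofReal τ * ∫⁻ ω, sqNorm (normSaw X c i ω m) ∂P
          + ENNReal.ofReal τ⁻¹ * ∫⁻ ω, sqNorm (normErr P X W c i ω m) ∂P) := by
      intro i
      simp only [hF]
      have hm : ∀ m, Measurable (fun ω => ENNReal.ofReal τ * sqNorm (normSaw X c i ω m)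
          + ENNReal.ofReal τ⁻¹ * sqNorm (normErr P X W c i ω m)) :=
        fun m => ((ms i m).const_mul _).add ((mr i m).const_mul _)
      rw [lintegral_finsetSum _ fun m _ => hm m]
      refine Finset.sum_congr rfl fun m _ => ?_
      rw [lintegral_add_left ((ms i m).const_mul _), lintegral_const_mul _ (ms i m),
        lintegral_const_mul _ (mr i m)]
    simp only [e1]
    rw [Finset.sum_comm, ENNReal.ofReal_sum_of_nonneg fun m _ => by have := hE m; positivity]
    refine Finset.sum_le_sum fun m _ => ?_
    have := hE m
    rw [Finset.sum_add_distrib, ← Finset.mul_sum, ← Finset.mul_sum,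
      ENNReal.ofReal_add (by positivity) (by positivity), ENNReal.ofReal_mul (p := τ) hτ.le,
      ENNReal.ofReal_mul (p := τ⁻¹) (by positivity)]
    gcongr
    · exact h.sum_lintegral_sqNorm_normSaw_le hc hcW m
    · exact h.sum_lintegral_sqNorm_normErr_le hc hcW hB0 hB m
  have h4 := h2.trans h3
  rw [← ofReal_measureReal (μ := P) (s := bad), ← ENNReal.ofReal_natCast,
    ← ENNReal.ofReal_mul hδ.le, ← ENNReal.ofReal_mul hN'.le, ENNReal.ofReal_le_ofReal_iff
      (Finset.sum_nonneg fun m _ => by have := hE m; positivity)] at h4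
  rw [← ofReal_measureReal (μ := P) (s := bad)]
  refine ENNReal.ofReal_le_ofReal ?_
  rw [← Finset.sum_div, le_div_iff₀ hδ]
  refine le_of_mul_le_mul_left (le_trans (le_of_eq (by ring)) (h4.trans (le_of_eq ?_))) hN'
  rw [Finset.mul_sum]
  refine Finset.sum_congr rfl fun m _ => ?_
  field_simp

end IsSparseWigner

/-! ### The upper tail with an explicit moment order. -/

namespace IsSparseWigner

variable {N : ℕ} {Ω : Type*} [MeasurableSpace Ω] {P : Measure Ω}
  {X : Ω → Matrix (Fin N) (Fin N) ℂ} {W : ℕ} {C α : ℝ}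

/-- The second moment is at most one, and `k ≤ 3 * (k - 2)` from `k = 3` on; hence the exponent `3 *
α`. -/
theorem lintegral_edgeVar_pow_le_pow_sub_two (h : IsSparseWigner P X W C α) {n : ℕ}
    (e : Sym2 (Fin N)) {k : ℕ} (hk : 2 ≤ k) (hkn : k ≤ n) :
    ∫⁻ ω, ‖edgeVar X e ω‖ₑ ^ k ∂P
      ≤ ENNReal.ofReal (((max C 1 * n) ^ (3 * α)) ^ (k - 2)) := by
  rcases eq_or_lt_of_le hk with rfl | hk3
  · simpa using h.lintegral_edgeVar_sq_le e
  refine (h.lintegral_edgeVar_pow_le e hk).trans (ENNReal.ofReal_le_ofReal ?_)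
  have hα := h.exponent_nonneg
  have hk' : (3 : ℝ) ≤ k := by exact_mod_cast hk3
  have hn' : (k : ℝ) ≤ n := by exact_mod_cast hkn
  have h1 : (1 : ℝ) ≤ max C 1 := le_max_right _ _
  have hbase : 1 ≤ max C 1 * n := by nlinarith
  rw [← Real.rpow_mul_natCast (by linarith), Nat.cast_sub hk]
  calc (C * k) ^ (α * k) ≤ (max C 1 * n) ^ (α * k) := by
        refine Real.rpow_le_rpow (mul_nonneg h.nonneg (by linarith)) ?_ (by positivity)
        exact mul_le_mul (le_max_left _ _) hn' (by linarith) (by linarith)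
    _ ≤ _ := by
        refine Real.rpow_le_rpow_of_exponent_le hbase ?_
        push_cast
        nlinarith

/-- The upper tail of the largest eigenvalue, under explicit conditions on the moment order `n`. -/
theorem measure_lambdaMax_ge_le_inv [IsProbabilityMeasure P] (h : IsSparseWigner P X W C α)
    {ε : ℝ} (hε : 0 < ε) (hN : 0 < N) (hW : 0 < W) {n : ℕ} (hn : 1 ≤ n) (hev : Even n)
    (h1 : (n : ℝ) ^ 3 ≤ ε / 8 * W)
    (h2 : (n : ℝ) ^ 4 * ((max C 1 * n) ^ (3 * α)) ^ 2 ≤ (ε / 4) ^ 2 * W)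
    (h3 : 2 * Real.log N ≤ n * Real.log ((2 + ε) / (2 + ε / 2))) :
    P {ω | (2 + ε) * √W ≤ lambdaMax (h.herm ω)} ≤ ENNReal.ofReal ((N : ℝ)⁻¹) := by
  have hW' : (0 : ℝ) < W := by exact_mod_cast hW
  have hN' : (0 : ℝ) < N := by exact_mod_cast hN
  have hn' : (1 : ℝ) ≤ n := by exact_mod_cast hn
  have hs : 0 < √(W : ℝ) := Real.sqrt_pos.2 hW'
  have hs2 : √(W : ℝ) ^ 2 = W := Real.sq_sqrt hW'.le
  set s := √(W : ℝ)
  set K : ℝ := (max C 1 * n) ^ (3 * α)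
  have hK : 1 ≤ K := by
    have := h.exponent_nonneg
    have h1 : (1 : ℝ) ≤ max C 1 := le_max_right _ _
    exact Real.one_le_rpow (by nlinarith) (by positivity)
  set γ := √((W : ℝ) + n ^ 3)
  have hγ : 0 < γ := Real.sqrt_pos.2 (by positivity)
  have hγ2 : γ ^ 2 = W + n ^ 3 := Real.sq_sqrt (by positivity)
  have hb := h.measure_lambdaMax_ge_le hN hK hγ hn hγ2 le_rfl hev
    (fun e k hk hkn => h.lintegral_edgeVar_pow_le_pow_sub_two e hk hkn)
    (a := (2 + ε) * s) (by positivity)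
  refine hb.trans (ENNReal.ofReal_le_ofReal ?_)
  -- The allowance `ε / 2` is split evenly: `ε / 4` for `2 * γ` and `ε / 4` for the reuse term.
  have e1 : γ ≤ (1 + ε / 8) * s := by
    refine le_of_sq_le_sq ?_ (by positivity)
    rw [hγ2, mul_pow, hs2]
    nlinarith
  have e2 : (n : ℝ) ^ 2 * K ≤ ε / 4 * s := by
    refine le_of_sq_le_sq ?_ (by positivity)
    rw [mul_pow, mul_pow, hs2, ← pow_mul]
    exact h2
  have e3 : (2 * γ + (n : ℝ) ^ 2 * K) / ((2 + ε) * s) ≤ (2 + ε / 2) / (2 + ε) := by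
    rw [div_le_div_iff₀ (by positivity) (by positivity)]
    have : 2 * γ + (n : ℝ) ^ 2 * K ≤ (2 + ε / 2) * s := by linarith
    nlinarith
  have hq : 0 < (2 + ε / 2) / (2 + ε) := by positivity
  -- One factor `N⁻¹` cancels the dimension from the trace, the other is the final bound.
  have e4 : ((2 + ε / 2) / (2 + ε)) ^ n ≤ ((N : ℝ) ^ 2)⁻¹ := by
    rw [← Real.log_le_log_iff (by positivity) (by positivity), Real.log_pow, Real.log_inv,
      Real.log_pow, ← inv_div, Real.log_inv]
    push_cast
    linarith
  calc _ ≤ (N : ℝ) * ((2 + ε / 2) / (2 + ε)) ^ n := by gcongr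
    _ ≤ N * ((N : ℝ) ^ 2)⁻¹ := by gcongr
    _ = _ := by field_simp

end IsSparseWigner

/-- With `n` of order `log N`, the conditions ask `W` to dominate `log N` to the powers `3` and `4 +
6 * α`, neither of which exceeds `6 * (1 + α)`. -/
theorem exists_even_moment_order {W : ℕ → ℕ} {C α ε : ℝ} (hα : 0 ≤ α) (hε : 0 < ε)
    (hWlog : (fun N : ℕ => Real.log N ^ (6 * (1 + α))) =o[atTop] (fun N : ℕ => (W N : ℝ))) :
    ∀ᶠ N : ℕ in atTop, ∃ n : ℕ, 1 ≤ n ∧ Even n ∧ (n : ℝ) ^ 3 ≤ ε / 8 * W N ∧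
      (n : ℝ) ^ 4 * ((max C 1 * n) ^ (3 * α)) ^ 2 ≤ (ε / 4) ^ 2 * W N ∧
      2 * Real.log N ≤ n * Real.log ((2 + ε) / (2 + ε / 2)) := by
  set ℓ := Real.log ((2 + ε) / (2 + ε / 2))
  have hℓ : 0 < ℓ := Real.log_pos (by rw [lt_div_iff₀ (by positivity)]; linarith)
  -- Rounding gives `n ≤ 2 * ℓ⁻¹ * L + 4`, which is at most `A * L` as soon as `L ≥ 1`; this holds
  -- for `N ≥ 3`.
  set A : ℝ := 2 * ℓ⁻¹ + 4
  have hA : 0 < A := by positivity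
  have hC : 1 ≤ max C 1 := le_max_right _ _
  have c1 : 0 < A ^ 3 := by positivity
  have c2 : 0 < A ^ 4 * ((max C 1 * A) ^ (3 * α)) ^ 2 := by positivity
  filter_upwards [eventually_ge_atTop 3, hWlog.bound (c := ε / 8 / A ^ 3) (by positivity),
    hWlog.bound (c := (ε / 4) ^ 2 / (A ^ 4 * ((max C 1 * A) ^ (3 * α)) ^ 2)) (by positivity)]
    with N hN3 hb1 hb2
  have hN3' : (3 : ℝ) ≤ N := by exact_mod_cast hN3
  set L := Real.log N
  have hL : 1 ≤ L := by
    rw [Real.le_log_iff_exp_le (by linarith)]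
    exact (Real.exp_one_lt_three.le).trans hN3'
  have hL0 : 0 < L := by linarith
  have hpos : 0 ≤ L ^ (6 * (1 + α)) := by positivity
  rw [Real.norm_of_nonneg hpos, Real.norm_of_nonneg (Nat.cast_nonneg _)] at hb1 hb2
  refine ⟨2 * (⌈ℓ⁻¹ * L⌉₊ + 1), by omega, even_two_mul _, ?_⟩
  have hn1 : ((2 * (⌈ℓ⁻¹ * L⌉₊ + 1) : ℕ) : ℝ) ≤ A * L := by
    have := (Nat.ceil_lt_add_one (a := ℓ⁻¹ * L) (by positivity)).le
    push_cast
    simp only [A]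
    nlinarith
  have hn2 : 2 * (ℓ⁻¹ * L) ≤ ((2 * (⌈ℓ⁻¹ * L⌉₊ + 1) : ℕ) : ℝ) := by
    have := Nat.le_ceil (ℓ⁻¹ * L)
    push_cast
    linarith
  set n : ℕ := 2 * (⌈ℓ⁻¹ * L⌉₊ + 1)
  have hn0 : (0 : ℝ) ≤ n := Nat.cast_nonneg _
  refine ⟨?_, ?_, ?_⟩
  · calc (n : ℝ) ^ 3 ≤ (A * L) ^ 3 := by gcongr
      _ = A ^ 3 * L ^ (3 : ℝ) := by rw [mul_pow]; norm_cast
      _ ≤ A ^ 3 * L ^ (6 * (1 + α)) := by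
          gcongr
          linarith
      _ ≤ A ^ 3 * (ε / 8 / A ^ 3 * W N) := by gcongr
      _ = _ := by field_simp
  · calc (n : ℝ) ^ 4 * ((max C 1 * n) ^ (3 * α)) ^ 2
        ≤ (A * L) ^ 4 * ((max C 1 * (A * L)) ^ (3 * α)) ^ 2 := by gcongr
      _ = A ^ 4 * ((max C 1 * A) ^ (3 * α)) ^ 2 * (L ^ 4 * (L ^ (3 * α)) ^ 2) := by
          rw [← mul_assoc, Real.mul_rpow (by positivity) hL0.le]
          ring
      _ = A ^ 4 * ((max C 1 * A) ^ (3 * α)) ^ 2 * L ^ (4 + 6 * α) := by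
          congr 1
          rw [← Real.rpow_mul_natCast hL0.le, Real.rpow_add hL0]
          congr 1
          · norm_cast
          · congr 1; push_cast; ring
      _ ≤ A ^ 4 * ((max C 1 * A) ^ (3 * α)) ^ 2 * L ^ (6 * (1 + α)) := by
          gcongr
          linarith
      _ ≤ A ^ 4 * ((max C 1 * A) ^ (3 * α)) ^ 2 *
          ((ε / 4) ^ 2 / (A ^ 4 * ((max C 1 * A) ^ (3 * α)) ^ 2) * W N) := by gcongr
      _ = _ := by field_simp
  · calc 2 * L = 2 * (ℓ⁻¹ * L) * ℓ := by field_simp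
      _ ≤ _ := by gcongr

/-! ### Conclusion: the two tails combined. -/

theorem theorem2p2
    -- for every `N`, a probability space carrying an `N × N` random matrix `X N`
    {Ω : ℕ → Type*} [∀ N, MeasurableSpace (Ω N)]
    (P : ∀ N, Measure (Ω N)) [∀ N, IsProbabilityMeasure (P N)]
    (X : ∀ N, Ω N → Matrix (Fin N) (Fin N) ℂ)
    (hmeas : ∀ N i j, Measurable (fun ω => X N ω i j))
    -- `X N` is Hermitian, with independent entries modulo the symmetry
    (hherm : ∀ N ω, (X N ω).IsHermitian)
    (hindep : ∀ N, iIndepFun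
      (fun (p : {p : Fin N × Fin N // p.1 ≤ p.2}) (ω : Ω N) => X N ω p.1.1 p.1.2) (P N))
    -- `1 ≪ W ≪ N`
    (W : ℕ → ℕ)
    (hW1 : (fun _ : ℕ => (1 : ℝ)) =o[atTop] (fun N : ℕ => (W N : ℝ)))
    (hWN : (fun N : ℕ => (W N : ℝ)) =o[atTop] (fun N : ℕ => (N : ℝ)))
    -- each row has at most `W` nonzero entries, with equality for all but `o(N)` rows
    (hrow_le : ∀ N i, rowCount (P N) (X N) i ≤ W N)
    (hrow_eq : (fun N : ℕ => (({i : Fin N | rowCount (P N) (X N) i ≠ W N}.ncard : ℕ) : ℝ))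
      =o[atTop] (fun N : ℕ => (N : ℝ)))
    -- the nonzero entries are centered with variance one
    (hmean : ∀ N i j, EntryNonzero (P N) (X N) i j → ∫ ω, X N ω i j ∂(P N) = 0)
    (hvar : ∀ N i j, EntryNonzero (P N) (X N) i j → ∫ ω, ‖X N ω i j‖ ^ 2 ∂(P N) = 1)
    -- `E |X_ij| ^ k ≤ (C k) ^ (α k)`, the expectation being taken in `[0, ∞]`
    (C α : ℝ) (hC : 0 ≤ C) (hα : 0 ≤ α)
    (hmoment : ∀ N i j, ∀ k : ℕ, 2 ≤ k →
      ∫⁻ ω, ‖X N ω i j‖ₑ ^ k ∂(P N) ≤ ENNReal.ofReal ((C * k) ^ (α * k)))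
    -- `W ≫ (log N) ^ (6 (1 + α))`
    (hWlog : (fun N : ℕ => Real.log N ^ (6 * (1 + α))) =o[atTop] (fun N : ℕ => (W N : ℝ))) :
    -- `λ_max(X) / √W → 2` in probability
    ∀ ε : ℝ, 0 < ε → Tendsto
      (fun N : ℕ => P N {ω | ε ≤ |lambdaMax (hherm N ω) / Real.sqrt (W N) - 2|})
      atTop (𝓝 0) := by
  intro ε hε
  have h : ∀ N, IsSparseWigner (P N) (X N) (W N) C α := fun N =>
    ⟨hmeas N, hherm N, hindep N, hrow_le N, hmean N, hvar N, hC, hα, hmoment N⟩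
  -- The order `d` and hence `δ`, `B` and `T` depend on `ε`, `C` and `α` only; `N` enters the lower
  -- tail through `η` alone.
  obtain ⟨d, hd⟩ := exists_nat_gt (8 / ε)
  have hd0 : (0 : ℝ) < d := (by positivity : (0 : ℝ) < 8 / ε).trans hd
  have hd1 : 1 ≤ d := by
    have : 0 < d := by exact_mod_cast hd0
    omega
  have hdε : 8 / (d : ℝ) < ε := by
    rw [div_lt_iff₀ hε] at hd
    rw [div_lt_iff₀ hd0]
    linarith
  set δ : ℝ := 1 / (2 * ((d : ℝ) ^ 2 * 4 ^ d)) with hδ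
  have hδ0 : 0 < δ := by positivity
  have hdδ : (d : ℝ) ^ 2 * 4 ^ d * δ ≤ 1 / 2 := le_of_eq (by rw [hδ]; field_simp)
  set B : ℝ := (C * (4 : ℕ)) ^ (α * (4 : ℕ)) with hBdef
  have hB0 : 0 ≤ B := Real.rpow_nonneg (by positivity) _
  have hB : ∀ N e, ∫⁻ ω, ‖edgeVar (X N) e ω‖ₑ ^ 4 ∂(P N) ≤ ENNReal.ofReal B :=
    fun N e => (h N).lintegral_edgeVar_pow_le e (by norm_num)
  set η : ℕ → ℝ := fun N => 1 / (W N : ℝ) +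
    ({i : Fin N | rowCount (P N) (X N) i ≠ W N}.ncard : ℝ) / N with hη
  have hη0 : Tendsto η atTop (𝓝 0) := by
    have := hW1.tendsto_div_nhds_zero.add hrow_eq.tendsto_div_nhds_zero
    rw [add_zero] at this
    exact this
  set T : ℝ := ∑ m ∈ Finset.range (2 * d + 2), ((m.factorial : ℝ) + errConst B m) / δ with hT
  have hlim : Tendsto (fun N : ℕ => ENNReal.ofReal ((N : ℝ)⁻¹) + ENNReal.ofReal (√(η N) * T))
      atTop (𝓝 0) := by
    have e1 : Tendsto (fun N : ℕ => ENNReal.ofReal ((N : ℝ)⁻¹)) atTop (𝓝 0) := by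
      simpa using ENNReal.tendsto_ofReal (tendsto_inv_atTop_nhds_zero_nat (𝕜 := ℝ))
    have e2 : Tendsto (fun N : ℕ => ENNReal.ofReal (√(η N) * T)) atTop (𝓝 0) := by
      have := ENNReal.tendsto_ofReal (hη0.sqrt.mul_const T)
      simpa using this
    simpa using e1.add e2
  refine tendsto_of_tendsto_of_tendsto_of_le_of_le' tendsto_const_nhds hlim
    (Eventually.of_forall fun _ => zero_le) ?_
  have hWpos : ∀ᶠ N in atTop, 0 < W N := by
    filter_upwards [hW1.bound (c := 1) one_pos] with N hN
    rw [norm_one, one_mul, Real.norm_of_nonneg (Nat.cast_nonneg _)] at hN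
    have : (0 : ℝ) < W N := by linarith
    exact_mod_cast this
  filter_upwards [hWpos, eventually_gt_atTop 0, exists_even_moment_order (C := C) hα hε hWlog]
    with N hW hN hmo
  obtain ⟨n, hn1, hev, hn3, hn4, hnlog⟩ := hmo
  have hW' : (0 : ℝ) < W N := by exact_mod_cast hW
  have hs : 0 < √(W N : ℝ) := Real.sqrt_pos.2 hW'
  have hηpos : 0 < η N := add_pos_of_pos_of_nonneg (by positivity) (by positivity)
  have hup := (h N).measure_lambdaMax_ge_le_inv hε hN hW hn1 hev hn3 hn4 hnlog
  -- The choice `τ = √(η N)` balances `τ` against `τ⁻¹ * η N`, so the whole bound is a constant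
  -- times `√(η N)`.
  have hlow := (h N).measure_lambdaMax_lt_le hN hW hB0 (hB N) hd1 hδ0 hdδ
    (Real.sqrt_pos.2 hηpos)
  have hsum : ∑ m ∈ Finset.range (2 * d + 2), (√(η N) * (m.factorial : ℝ) +
      (√(η N))⁻¹ * (errConst B m * η N)) / δ = √(η N) * T := by
    rw [hT, Finset.mul_sum]
    refine Finset.sum_congr rfl fun m _ => ?_
    have e1 : (√(η N))⁻¹ * (errConst B m * η N) = √(η N) * errConst B m := by
      have e2 := Real.mul_self_sqrt hηpos.le
      have e3 := (Real.sqrt_pos.2 hηpos).ne'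
      rw [inv_mul_eq_iff_eq_mul₀ e3, ← mul_assoc, e2, mul_comm]
    rw [e1]
    ring
  rw [hsum] at hlow
  refine le_trans (measure_mono ?_) ((measure_union_le _ _).trans (add_le_add hup hlow))
  intro ω hω
  rcases le_abs.1 (show ε ≤ |lambdaMax (hherm N ω) / √(W N : ℝ) - 2| from hω) with h1 | h1
  · left
    have : 2 + ε ≤ lambdaMax (hherm N ω) / √(W N : ℝ) := by linarith
    exact (le_div_iff₀ hs).1 this
  · right
    have h2 : lambdaMax (hherm N ω) / √(W N : ℝ) < 2 - 8 / d := by linarith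
    rw [div_lt_iff₀ hs, mul_comm] at h2
    exact h2
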